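/- Fix $\alpha>0$ and an additive map $\mathbb N_0^2\ni\mathbf n\mapsto|\mathbf n|\in\mathbb R$ with $|(1,0)|,|(0,1)|>0$. **Multi-indices.** Consider the variables $\mathsf z_k$ ($k\in\mathbb N_0$) and $\mathsf z_{\mathbf n}$ ($\mathbf n\in\mathbb N_0^2\setminus\{\mathbf 0\}$). A multi-index $\gamma$ is a finitely supported $\mathbb N_0$-valued function on the set of these variables, $e_k$ and $e_{\mathbf n}$ are the unit multi-indices, and $\mathsf z^\gamma$ is the corresponding monomial. Put $$[\gamma]=\sum_{k\ge0}k\,\gamma(k)-\sum_{\mathbf n\ne\mathbf 0}\gamma(\mathbf n),\qquad |\gamma|=\alpha([\gamma]+1)+\sum_{\mathbf n\neq\mathbf 0}|\mathbf n|\,\gamma(\mathbf n).$$ **The spaces $\mathsf T$ and $\mathsf T^*$.** Let $\mathsf T^*\subset\mathbb R[[\mathsf z_k,\mathsf z_{\mathbf n}]]$ be the space of power series whose coefficients vanish except at multi-indices $\gamma$ with $[\gamma]\ge0$ or $\gamma=e_{\mathbf n}$ for some $\mathbf n\ne\mathbf 0$. Let $\mathsf T$ be the real vector space with basis $\{\mathsf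 z_\gamma\}$ indexed by these $\gamma$. **The Lie algebra $\mathsf L$.** On $\mathbb R[[\mathsf z_k,\mathsf z_{\mathbf n}]]$ define the derivations $$D^{(\mathbf 0)}=\sum_{k\ge0}(k+1)\mathsf z_{k+1}\partial_{\mathsf z_k},\qquad D^{(\mathbf n)}=\partial_{\mathsf z_{\mathbf n}}\ (\mathbf n\neq\mathbf 0),\qquad \partial_i=\sum_{\mathbf n\in\mathbb N_0^2}(n_i+1)\,\mathsf z_{\mathbf n+\mathbf u_i}D^{(\mathbf n)}\ (i=1,2),$$ where $\mathbf u_1=(1,0)$ and $\mathbf u_2=(0,1)$. Let $\mathsf L$ be the Lie algebra, under the commutator, spanned by $\partial_1,\partial_2$ and all $\mathsf z^\gamma D^{(\mathbf n)}$ with $[\gamma]\ge0$ and $|\gamma|>|\mathbf n|$; we call such pairs $(\gamma,\mathbf n)$ admissible. Let ${\rm U}(\mathsf L)$ be its universal enveloping algebra, and let $\rho:{\rm U}(\mathsf L)\to{\rm End}(\mathsf T^*)$ be the algebra morphism extending the action of $\mathsf L$ on $\mathsf T^*$. **The elements $D_{(J,\mathbf m)}$.** For admissible $(\gamma,\mathbf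 n)$ let $U\mapsto\mathsf z^\gamma UD^{(\mathbf n)}$ be the linear endomorphisms of ${\rm U}(\mathsf L)$ determined by $\mathsf z^\gamma 1D^{(\mathbf n)}=\mathsf z^\gamma D^{(\mathbf n)}$ and $$\mathsf z^\gamma DUD^{(\mathbf n)}=D\,(\mathsf z^\gamma UD^{(\mathbf n)})-\sum_\beta D_\beta^\gamma\,\mathsf z^\beta UD^{(\mathbf n)}\qquad(D\in\mathsf L,\ U\in{\rm U}(\mathsf L)),$$ where $D\mathsf z^\gamma=\sum_\beta D^\gamma_\beta\mathsf z^\beta$; these endomorphisms commute with each other. For $\mathbf m\in\mathbb N_0^2$ and a finitely supported $\mathbb N_0$-valued function $J$ on admissible pairs, let $D_{(J,\mathbf m)}\in{\rm U}(\mathsf L)$ be $\frac1{J!\,\mathbf m!}$ times the result of applying to $\partial_1^{m_1}\partial_2^{m_2}$ each of these endomorphisms $J(\gamma,\mathbf n)$ times. Let $\mathsf T^+$ be the real polynomial algebra in variables indexed by the admissible pairs and $\{1,2\}$, with monomials $Z^{(J,\mathbf m)}$, so that $Z^{(J',\mathbf m')}Z^{(J'',\mathbf m'')}=Z^{(J',\mathbf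 m')+(J'',\mathbf m'')}$. **Claim.** 1. The $D_{(J,\mathbf m)}$ form a basis of ${\rm U}(\mathsf L)$. Write $$D_{(J',\mathbf m')}D_{(J'',\mathbf m'')}=\sum_{(J,\mathbf m)}(\Delta^+)^{(J,\mathbf m)}_{(J',\mathbf m')(J'',\mathbf m'')}D_{(J,\mathbf m)},$$ and let $\Delta^\gamma_{\beta\,(J,\mathbf m)}$ be the coefficient of $\mathsf z^\beta$ in $\rho(D_{(J,\mathbf m)})\mathsf z^\gamma$, for $\beta,\gamma$ in the index set of $\mathsf T$. For each $(J,\mathbf m)$ only finitely many of the numbers $(\Delta^+)^{(J,\mathbf m)}_{(J',\mathbf m')(J'',\mathbf m'')}$ are non-zero, and for each $\beta$ only finitely many of the numbers $\Delta^\gamma_{\beta\,(J,\mathbf m)}$ are non-zero. Hence the following linear maps $\Delta^+:\mathsf T^+\to\mathsf T^+\otimes\mathsf T^+$ and $\Delta:\mathsf T\to\mathsf T^+\otimes\mathsf T$ are well defined: $$\Delta^+Z^{(J,\mathbf m)}=\sum(\Delta^+)^{(J,\mathbf m)}_{(J',\mathbf m')(J'',\mathbf m'')}Z^{(J',\mathbf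 m')}\otimes Z^{(J'',\mathbf m'')},\qquad \Delta\mathsf z_\beta=\sum\Delta^\gamma_{\beta\,(J,\mathbf m)}Z^{(J,\mathbf m)}\otimes\mathsf z_\gamma.$$ 2. There is a linear map $\mathcal S:\mathsf T^+\to\mathsf T^+$ such that $\mathsf T^+$, with its polynomial product, the coproduct $\Delta^+$, the counit $\varepsilon$ given by $\varepsilon(Z^{(J,\mathbf m)})=1$ if $(J,\mathbf m)=(0,\mathbf 0)$ and $0$ otherwise, and the antipode $\mathcal S$, is a Hopf algebra. 3. $(\mathsf T,\Delta)$ is a left comodule over $\mathsf T^+$: $(\mathrm{id}\otimes\Delta)\Delta=(\Delta^+\otimes\mathrm{id})\Delta$ and $(\varepsilon\otimes\mathrm{id})\Delta=\mathrm{id}$. -/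

import Mathlib

open MvPowerSeries
open scoped TensorProduct

noncomputable section
namespace MultiIndexHopf

section VectorFields
variable {σ : Type*}

/-- For each `β`, only finitely many `a i` have a non-zero coefficient at some `δ ≤ β`. -/
def IsLocFin (a : σ → MvPowerSeries σ ℝ) : Prop :=
  ∀ β : σ →₀ ℕ, {i | ∃ δ ≤ β, coeff δ (a i) ≠ 0}.Finite

theorem coeff_mul_eq_zero {a g : MvPowerSeries σ ℝ} {δ : σ →₀ ℕ}
    (h : ∀ ε ≤ δ, coeff ε a = 0) : coeff δ (a * g) = 0 := by
  classical
  rw [coeff_mul]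
  refine Finset.sum_eq_zero fun p hp => ?_
  rw [h p.1 (Finset.HasAntidiagonal.mem_antidiagonal.1 hp ▸ le_self_add), zero_mul]

theorem coeff_mul_congr {f g g' : MvPowerSeries σ ℝ} {β : σ →₀ ℕ}
    (h : ∀ δ ≤ β, coeff δ g = coeff δ g') : coeff β (f * g) = coeff β (f * g') := by
  rw [← sub_eq_zero, ← map_sub, ← mul_sub, mul_comm]
  exact coeff_mul_eq_zero fun ε hε => by rw [map_sub, h ε hε, sub_self]

/-- The power series with coefficients `∑ i, (a i * ∂f/∂z_i)_β`. -/
def vectorFieldFun (a : σ → MvPowerSeries σ ℝ) (f : MvPowerSeries σ ℝ) : MvPowerSeries σ ℝ :=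
  fun β => ∑ᶠ i, coeff β (a i * pderiv ℝ i f)

theorem coeff_vectorFieldFun {a : σ → MvPowerSeries σ ℝ} (ha : IsLocFin a) {β δ : σ →₀ ℕ}
    (h : δ ≤ β) (f : MvPowerSeries σ ℝ) :
    coeff δ (vectorFieldFun a f) = coeff δ (∑ i ∈ (ha β).toFinset, a i * pderiv ℝ i f) := by
  rw [map_sum]
  refine finsum_eq_sum_of_support_subset _ fun i hi => ?_
  simp only [Set.Finite.coe_toFinset, Set.mem_ofPred_eq]
  by_contra hcon
  push Not at hcon
  exact hi (coeff_mul_eq_zero fun ε hε => hcon ε (hε.trans h))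

/-- The derivation `∑ i, a i * ∂/∂z_i` of `ℝ[[z]]`. -/
def vectorField (a : σ → MvPowerSeries σ ℝ) (ha : IsLocFin a) :
    Derivation ℝ (MvPowerSeries σ ℝ) (MvPowerSeries σ ℝ) :=
  Derivation.mk'
    { toFun := vectorFieldFun a
      map_add' := fun f g => by
        ext β
        rw [map_add]
        simp only [coeff_vectorFieldFun ha le_rfl, map_add, mul_add, Finset.sum_add_distrib]
      map_smul' := fun c f => by
        ext β
        rw [RingHom.id_apply, coeff_smul]
        simp only [coeff_vectorFieldFun ha le_rfl, map_sum, Finset.mul_sum]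
        refine Finset.sum_congr rfl fun i _ => ?_
        rw [Derivation.map_smul, mul_smul_comm, coeff_smul] }
    fun f g => by
      ext β
      have h1 : ∀ f g : MvPowerSeries σ ℝ, coeff β (f * vectorFieldFun a g)
          = coeff β (f * ∑ i ∈ (ha β).toFinset, a i * pderiv ℝ i g) := fun f g =>
        coeff_mul_congr fun δ hδ => coeff_vectorFieldFun ha hδ g
      simp only [LinearMap.coe_mk, AddHom.coe_mk, smul_eq_mul, map_add, h1,
        coeff_vectorFieldFun ha le_rfl]
      rw [← map_add]
      congr 1
      rw [Finset.mul_sum, Finset.mul_sum, ← Finset.sum_add_distrib]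
      refine Finset.sum_congr rfl fun i _ => ?_
      rw [Derivation.leibniz]
      simp only [smul_eq_mul]
      ring

theorem coeff_vectorField {a : σ → MvPowerSeries σ ℝ} (ha : IsLocFin a) (β : σ →₀ ℕ)
    (f : MvPowerSeries σ ℝ) :
    coeff β (vectorField a ha f) = ∑ i ∈ (ha β).toFinset, coeff β (a i * pderiv ℝ i f) := by
  rw [← map_sum]
  exact coeff_vectorFieldFun ha le_rfl f

theorem coeff_vectorField_of_subset {a : σ → MvPowerSeries σ ℝ} (ha : IsLocFin a) (β : σ →₀ ℕ)
    (f : MvPowerSeries σ ℝ) (s : Finset σ) (hs : ∀ i, i ∉ s → pderiv ℝ i f = 0) :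
    coeff β (vectorField a ha f) = ∑ i ∈ s, coeff β (a i * pderiv ℝ i f) := by
  refine finsum_eq_sum_of_support_subset _ fun i hi => ?_
  by_contra hcon
  exact hi (by simp only [hs i hcon, mul_zero, map_zero])

theorem pderiv_monomial_one (i : σ) (γ : σ →₀ ℕ) :
    pderiv ℝ i (monomial γ (1 : ℝ))
      = (γ i : ℝ) • monomial (γ - Finsupp.single i 1) (1 : ℝ) := by
  have h := pderiv_coe (R := ℝ) (i := i) (MvPolynomial.monomial γ (1 : ℝ))
  rw [MvPolynomial.coe_monomial, MvPolynomial.pderiv_monomial, MvPolynomial.coe_monomial] at h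
  rw [h, one_mul, ← map_smul, smul_eq_mul, mul_one]

theorem vectorField_X {a : σ → MvPowerSeries σ ℝ} (ha : IsLocFin a) (i : σ) :
    vectorField a ha (X i) = a i := by
  ext β
  rw [coeff_vectorField_of_subset ha β (X i) {i} fun j hj => ?_]
  · rw [Finset.sum_singleton, pderiv_X_self, mul_one]
  · exact pderiv_X_of_ne fun h => hj (Finset.mem_singleton.2 h.symm)

theorem vectorField_monomial {a : σ → MvPowerSeries σ ℝ} (ha : IsLocFin a) (γ : σ →₀ ℕ) :
    vectorField a ha (monomial γ 1)
      = ∑ i ∈ γ.support, (γ i : ℝ) • (a i * monomial (γ - Finsupp.single i 1) 1) := by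
  ext β
  rw [coeff_vectorField_of_subset ha β _ γ.support fun j hj => ?_, map_sum]
  · refine Finset.sum_congr rfl fun i _ => ?_
    rw [pderiv_monomial_one, mul_smul_comm]
  · rw [pderiv_monomial_one, Finsupp.notMem_support_iff.1 hj, Nat.cast_zero, zero_smul]

open scoped MvPowerSeries.WithPiTopology in
theorem continuous_vectorField {a : σ → MvPowerSeries σ ℝ} (ha : IsLocFin a) :
    Continuous (vectorField a ha) := by
  classical
  refine continuous_pi fun β => ?_
  have : (fun f => vectorField a ha f β) = fun f : MvPowerSeries σ ℝ =>
      ∑ i ∈ (ha β).toFinset, coeff β (a i * pderiv ℝ i f) := by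
    funext f; exact coeff_vectorField ha β f
  rw [this]
  refine continuous_finsetSum _ fun i _ => ?_
  simp only [coeff_mul, coeff_pderiv]
  refine continuous_finsetSum _ fun p _ => ?_
  exact continuous_const.mul ((WithPiTopology.continuous_coeff ℝ _).mul continuous_const)

open scoped MvPowerSeries.WithPiTopology in
/-- Continuous derivations of `ℝ[[z]]` are determined by their values on the variables. -/
theorem derivation_ext_of_continuous
    {D D' : Derivation ℝ (MvPowerSeries σ ℝ) (MvPowerSeries σ ℝ)}
    (hD : Continuous D) (hD' : Continuous D') (h : ∀ i, D (X i) = D' (X i)) : D = D' := by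
  have key : (D : MvPowerSeries σ ℝ → MvPowerSeries σ ℝ) = D' := by
    refine DenseRange.equalizer (WithPiTopology.denseRange_toMvPowerSeries (R := ℝ)) hD hD' ?_
    funext p
    induction p using MvPolynomial.induction_on with
    | C r =>
      simp only [Function.comp_apply, MvPolynomial.coe_C]
      exact (D.map_algebraMap r).trans (D'.map_algebraMap r).symm
    | add p q hp hq =>
      simp only [Function.comp_apply, MvPolynomial.coe_add, map_add] at *
      rw [hp, hq]
    | mul_X p i hp =>
      simp only [Function.comp_apply, MvPolynomial.coe_mul, MvPolynomial.coe_X,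
        Derivation.leibniz] at *
      rw [hp, h]
  exact DFunLike.coe_injective key

theorem isLocFin_monomial {s : σ → σ →₀ ℕ} {c : σ → ℝ}
    (h : ∀ β : σ →₀ ℕ, {i | s i ≤ β ∧ c i ≠ 0}.Finite) : IsLocFin fun i => monomial (s i) (c i) := by
  refine fun β => (h β).subset ?_
  rintro i ⟨δ, hδ, hne⟩
  have hs := eq_of_coeff_monomial_ne_zero hne
  refine ⟨hs ▸ hδ, fun hc => hne ?_⟩
  simp only [hc, map_zero]

/-- The coefficient of `z^β` in `∑ i, c_i z^(s_i) ∂z^γ/∂z_i` can only be non-zero if this relation holds. -/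
def Step (s : σ → σ →₀ ℕ) (c : σ → ℝ) (γ β : σ →₀ ℕ) : Prop :=
  ∃ i, γ i ≠ 0 ∧ c i ≠ 0 ∧ β + Finsupp.single i 1 = γ + s i

theorem exists_step {s : σ → σ →₀ ℕ} {c : σ → ℝ} (ha : IsLocFin fun i => monomial (s i) (c i))
    {f : MvPowerSeries σ ℝ} {β : σ →₀ ℕ} (h : coeff β (vectorField _ ha f) ≠ 0) :
    ∃ γ, coeff γ f ≠ 0 ∧ Step s c γ β := by
  rw [coeff_vectorField] at h
  obtain ⟨i, -, hi⟩ := Finset.exists_ne_zero_of_sum_ne_zero h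
  rw [coeff_monomial_mul] at hi
  split_ifs at hi with hle
  · rw [coeff_pderiv] at hi
    refine ⟨β - s i + Finsupp.single i 1, fun h0 => hi (by rw [h0]; ring), i, by simp,
      fun h0 => hi (by rw [h0]; ring), ?_⟩
    rw [add_right_comm, tsub_add_cancel_of_le hle]
  · exact absurd rfl hi

theorem vectorField_monomial_mem_span {s : σ → σ →₀ ℕ} {c : σ → ℝ}
    (ha : IsLocFin fun i => monomial (s i) (c i)) {γ : σ →₀ ℕ} {W : Submodule ℝ (MvPowerSeries σ ℝ)}
    {g : σ →₀ ℕ} (h : ∀ β, Step s c γ β → monomial (g + β) (1 : ℝ) ∈ W) :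
    monomial g 1 * vectorField _ ha (monomial γ 1) ∈ W := by
  rw [vectorField_monomial, Finset.mul_sum]
  refine W.sum_mem fun i hi => ?_
  rw [mul_smul_comm]
  refine W.smul_mem _ ?_
  rw [monomial_mul_monomial, monomial_mul_monomial, mul_one, one_mul]
  by_cases hc : c i = 0
  · rw [hc, map_zero]; exact W.zero_mem
  · have hi' := Finsupp.mem_support_iff.1 hi
    have := W.smul_mem (c i) (h (s i + (γ - Finsupp.single i 1)) ⟨i, hi', hc, by
      rw [add_assoc, tsub_add_cancel_of_le (by simpa [Nat.one_le_iff_ne_zero] using hi'),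
        add_comm]⟩)
    rwa [← map_smul, smul_eq_mul, mul_one] at this

theorem lie_smul_smul {A : Type*} [CommRing A] [Algebra ℝ A] (f g : A) (D D' : Derivation ℝ A A) :
    ⁅f • D, g • D'⁆ = (f * D g) • D' - (g * D' f) • D + (f * g) • ⁅D, D'⁆ := by
  ext x
  simp only [Derivation.commutator_apply, Derivation.smul_apply, Derivation.add_apply,
    Derivation.sub_apply, Derivation.leibniz, smul_eq_mul]
  ring

end VectorFields

/-- Elements `n` of `ℕ₀²`. -/
abbrev N2 := Fin 2 → ℕ

/-- The unit vector `(1,0)` resp. `(0,1)`. -/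
def unit (i : Fin 2) : N2 := Pi.single i 1

/-- The index set `{k ≥ 0} ∪ {n ≠ 0}` of the variables `z_k`, `z_n`. -/
abbrev Var := ℕ ⊕ {n : N2 // n ≠ 0}

/-- Multi-indices. -/
abbrev MI := Var →₀ ℕ

/-- `ℝ[[z_k, z_n]]`. -/
abbrev PS := MvPowerSeries Var ℝ

/-- The monomial `z^γ`. -/
def mon (γ : MI) : PS := monomial γ 1

theorem add_unit_ne_zero (n : N2) (i : Fin 2) : n + unit i ≠ 0 := fun h => by
  have := congrFun h i
  simp [unit] at this

theorem unit_ne_zero (i : Fin 2) : unit i ≠ 0 := fun h => by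
  have := congrFun h i
  simp [unit] at this

/-- `z_(n + e_i)` -/
def varAdd (n : N2) (i : Fin 2) : Var := Sum.inr ⟨n + unit i, add_unit_ne_zero n i⟩

/-- Exponents of the values of `D^(n)` on the variables. -/
def tiltExp : Var → MI
  | Sum.inl k => Finsupp.single (Sum.inl (k + 1)) 1
  | Sum.inr _ => 0

/-- Coefficients of the values of `D^(n)` on the variables. -/
def tiltCoef (n : N2) : Var → ℝ
  | Sum.inl k => if n = 0 then (k : ℝ) + 1 else 0
  | Sum.inr m => if m.1 = n then 1 else 0

/-- Exponents of the values of `∂_i` on the variables. -/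
def shiftExp (i : Fin 2) : Var → MI
  | Sum.inl k => Finsupp.single (varAdd 0 i) 1 + Finsupp.single (Sum.inl (k + 1)) 1
  | Sum.inr m => Finsupp.single (varAdd m.1 i) 1

/-- Coefficients of the values of `∂_i` on the variables. -/
def shiftCoef (i : Fin 2) : Var → ℝ
  | Sum.inl k => (k : ℝ) + 1
  | Sum.inr m => (m.1 i : ℝ) + 1

theorem finite_inl (β : MI) (t : ℕ → MI) (ht : ∀ k, Finsupp.single (Sum.inl (k + 1)) 1 ≤ t k) :
    {k | t k ≤ β}.Finite := by
  have hinj : Function.Injective fun k : ℕ => (Sum.inl (k + 1) : Var) := fun a b h => by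
    simpa using h
  refine (β.support.finite_toSet.preimage hinj.injOn).subset fun k hk => ?_
  have := (ht k).trans hk
  simp only [Set.mem_preimage, Finset.mem_coe, Finsupp.mem_support_iff]
  have h1 := this (Sum.inl (k + 1))
  simp only [Finsupp.single_eq_same] at h1
  lia

theorem tilt_locFin (n : N2) : IsLocFin fun v => monomial (tiltExp v) (tiltCoef n v) := by
  refine isLocFin_monomial fun β => ?_
  refine (((finite_inl β (fun k => tiltExp (Sum.inl k)) fun k => le_rfl).image Sum.inl).union
    ((Set.finite_singleton n).preimage Subtype.val_injective.injOn |>.image Sum.inr)).subset ?_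
  rintro (k | m) ⟨h1, h2⟩
  · exact Or.inl ⟨k, h1, rfl⟩
  · refine Or.inr ⟨m, ?_, rfl⟩
    by_contra hm
    exact h2 (if_neg hm)

theorem varAdd_inj {n m : N2} {i : Fin 2} (h : varAdd n i = varAdd m i) : n = m := by
  simpa [varAdd] using h

theorem shift_locFin (i : Fin 2) : IsLocFin fun v => monomial (shiftExp i v) (shiftCoef i v) := by
  refine isLocFin_monomial fun β => ?_
  have hinj : Function.Injective fun m : {n : N2 // n ≠ 0} => varAdd m.1 i := fun a b h =>
    Subtype.ext (varAdd_inj h)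
  refine (((finite_inl β (fun k => shiftExp i (Sum.inl k)) fun k => le_add_self).image
    Sum.inl).union ((β.support.finite_toSet.preimage hinj.injOn).image Sum.inr)).subset ?_
  rintro (k | m) ⟨h1, h2⟩
  · exact Or.inl ⟨k, h1, rfl⟩
  · refine Or.inr ⟨m, ?_, rfl⟩
    have := h1 (varAdd m.1 i)
    simp only [shiftExp, Finsupp.single_eq_same] at this
    simp only [Set.mem_preimage, Finset.mem_coe, Finsupp.mem_support_iff]
    lia

/-- The derivation `D^(n)` of `ℝ[[z_k, z_n]]`: `D^(0) = ∑_k (k+1) z_(k+1) ∂/∂z_k`, and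
`D^(n) = ∂/∂z_n` for `n ≠ 0`. -/
def tilt (n : N2) : Derivation ℝ PS PS := vectorField _ (tilt_locFin n)

/-- The derivation `∂_i = ∑_n (n_i + 1) z_(n + e_i) D^(n)` of `ℝ[[z_k, z_n]]`. -/
def shift (i : Fin 2) : Derivation ℝ PS PS := vectorField _ (shift_locFin i)

theorem tilt_zero_inl (k : ℕ) :
    tilt 0 (X (Sum.inl k)) = ((k : ℝ) + 1) • X (Sum.inl (k + 1)) := by
  rw [tilt, vectorField_X, X, ← map_smul, smul_eq_mul, mul_one]
  simp [tiltExp, tiltCoef]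

theorem tilt_inl {n : N2} (hn : n ≠ 0) (k : ℕ) : tilt n (X (Sum.inl k)) = 0 := by
  rw [tilt, vectorField_X]
  simp [tiltCoef, hn]

theorem tilt_inr (n : N2) (m : {n : N2 // n ≠ 0}) :
    tilt n (X (Sum.inr m)) = if m.1 = n then 1 else 0 := by
  rw [tilt, vectorField_X]
  by_cases h : m.1 = n <;> simp [tiltCoef, tiltExp, h]

theorem tilt_varAdd (n m : N2) (i : Fin 2) :
    tilt n (X (varAdd m i)) = if m + unit i = n then 1 else 0 := tilt_inr n _

theorem shift_inl (i : Fin 2) (k : ℕ) :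
    shift i (X (Sum.inl k)) = ((k : ℝ) + 1) • (X (varAdd 0 i) * X (Sum.inl (k + 1))) := by
  rw [shift, vectorField_X, X, X, monomial_mul_monomial, ← map_smul, smul_eq_mul, mul_one, mul_one]
  rfl

theorem shift_inr (i : Fin 2) (m : {n : N2 // n ≠ 0}) :
    shift i (X (Sum.inr m)) = ((m.1 i : ℝ) + 1) • X (varAdd m.1 i) := by
  rw [shift, vectorField_X, X, ← map_smul, smul_eq_mul, mul_one]
  rfl

theorem shift_varAdd (i j : Fin 2) (m : N2) :
    shift i (X (varAdd m j)) = (((m + unit j) i : ℝ) + 1) • X (varAdd (m + unit j) i) :=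
  shift_inr i _

section Brackets
open scoped MvPowerSeries.WithPiTopology

theorem continuous_tilt (n : N2) : Continuous (tilt n) := continuous_vectorField _
theorem continuous_shift (i : Fin 2) : Continuous (shift i) := continuous_vectorField _

theorem continuous_lie {D D' : Derivation ℝ PS PS} (h : Continuous D) (h' : Continuous D') :
    Continuous (⁅D, D'⁆ : Derivation ℝ PS PS) := by
  have : ((⁅D, D'⁆ : Derivation ℝ PS PS) : PS → PS) = fun f => D (D' f) - D' (D f) := by
    funext f; exact Derivation.commutator_apply f
  rw [this]
  exact (h.comp h').sub (h'.comp h)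

theorem lie_tilt_tilt (n n' : N2) : ⁅tilt n, tilt n'⁆ = 0 := by
  refine derivation_ext_of_continuous (continuous_lie (continuous_tilt n) (continuous_tilt n'))
    continuous_const ?_
  have h1 : ∀ n n' : N2, ∀ m, tilt n (tilt n' (X (Sum.inr m))) = 0 := fun n n' m => by
    rw [tilt_inr]; split_ifs <;> simp
  have h2 : ∀ n n' : N2, n ≠ 0 → ∀ k, tilt n (tilt n' (X (Sum.inl k))) = 0 := fun n n' hn k => by
    by_cases hn' : n' = 0
    · subst hn'
      rw [tilt_zero_inl, Derivation.map_smul, tilt_inl hn, smul_zero]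
    · rw [tilt_inl hn', map_zero]
  have h3 : ∀ n n' : N2, n ≠ 0 → ∀ k, tilt n' (tilt n (X (Sum.inl k))) = 0 := fun n n' hn k => by
    rw [tilt_inl hn, map_zero]
  rintro (k | m)
  · rw [Derivation.commutator_apply]
    by_cases hn : n = 0
    · by_cases hn' : n' = 0
      · subst hn hn'; simp
      · rw [h2 n' n hn', h3 n' n hn']; simp
    · rw [h2 n n' hn, h3 n n' hn]; simp
  · rw [Derivation.commutator_apply, h1, h1]; simp

theorem lie_shift_shift (i j : Fin 2) : ⁅shift i, shift j⁆ = 0 := by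
  refine derivation_ext_of_continuous (continuous_lie (continuous_shift i) (continuous_shift j))
    continuous_const ?_
  have hc : ∀ m : N2, varAdd (m + unit i) j = varAdd (m + unit j) i := fun m => by
    simp only [varAdd, add_right_comm]
  rcases eq_or_ne i j with rfl | hij
  · intro v; simp
  have hu : ∀ m : N2, (m + unit i) j = m j := fun m => by simp [unit, hij.symm]
  have hu' : ∀ m : N2, (m + unit j) i = m i := fun m => by simp [unit, hij]
  rintro (k | m)
  · rw [Derivation.commutator_apply, Derivation.zero_apply]
    simp only [shift_inl, Derivation.map_smul, Derivation.leibniz, shift_varAdd, hc, hu, hu']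
    simp only [smul_eq_mul, Pi.zero_apply, Nat.cast_zero, zero_add, Algebra.smul_def]
    ring
  · rw [Derivation.commutator_apply, Derivation.zero_apply]
    simp only [shift_inr, Derivation.map_smul, shift_varAdd, hc, hu, hu', smul_smul]
    rw [mul_comm, sub_self]

theorem lie_tilt_shift (n : N2) (i : Fin 2) :
    ⁅tilt n, shift i⁆ = (n i : ℝ) • tilt (n - unit i) := by
  refine derivation_ext_of_continuous (continuous_lie (continuous_tilt n) (continuous_shift i))
    ((continuous_tilt _).const_smul (n i : ℝ)) ?_
  rintro (k | m)
  · rw [Derivation.commutator_apply, Derivation.smul_apply, shift_inl]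
    by_cases hn : n = 0
    · subst hn
      rw [tilt_zero_inl]
      simp only [Derivation.map_smul, Derivation.leibniz, shift_inl, tilt_zero_inl, tilt_varAdd,
        if_neg (add_unit_ne_zero _ _)]
      simp
    · rw [tilt_inl hn, map_zero, sub_zero, Derivation.map_smul, Derivation.leibniz, tilt_inl hn,
        tilt_varAdd, smul_zero, zero_add, zero_add]
      by_cases h : n = unit i
      · subst h
        simp [tilt_zero_inl, unit]
      · rw [if_neg (Ne.symm h), smul_zero, smul_zero]
        by_cases h0 : n i = 0
        · simp [h0]
        · rw [tilt_inl, smul_zero]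
          intro hz
          apply h
          funext j
          have := congrFun hz j
          simp only [Pi.sub_apply, Pi.zero_apply, unit, Pi.single_apply] at this ⊢
          split_ifs at this ⊢ with hj
          · subst hj; lia
          · lia
  · rw [Derivation.commutator_apply, Derivation.smul_apply, shift_inr, tilt_inr, tilt_inr,
      Derivation.map_smul, tilt_varAdd]
    have h0 : shift i (if m.1 = n then (1 : PS) else 0) = 0 := by split_ifs <;> simp
    rw [h0, sub_zero]
    by_cases h : m.1 + unit i = n
    · have h2 : m.1 = n - unit i := by rw [← h, add_tsub_cancel_right]
      rw [if_pos h, if_pos h2, ← h]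
      simp [unit]
    · rw [if_neg h, smul_zero]
      by_cases h0 : n i = 0
      · simp [h0]
      · rw [if_neg, smul_zero]
        intro h2
        apply h
        rw [h2]
        apply tsub_add_cancel_of_le
        intro j
        simp only [unit, Pi.single_apply]
        split_ifs with hj
        · subst hj; lia
        · lia

end Brackets

/-- `[γ] = ∑_k k γ(k) - ∑_(n ≠ 0) γ(n)` -/
def br (γ : MI) : ℤ := γ.sum fun v k => (k : ℤ) * Sum.elim (fun j : ℕ => (j : ℤ)) (fun _ => -1) v

theorem br_add (γ δ : MI) : br (γ + δ) = br γ + br δ :=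
  Finsupp.sum_add_index' (by simp) fun _ _ _ => by push_cast; ring

@[simp] theorem br_single_inl (k : ℕ) : br (Finsupp.single (Sum.inl k) 1) = k := by simp [br]
@[simp] theorem br_single_inr (m) : br (Finsupp.single (Sum.inr m) 1) = -1 := by simp [br]
@[simp] theorem br_single_varAdd (n i) : br (Finsupp.single (varAdd n i) 1) = -1 :=
  br_single_inr _
@[simp] theorem br_zero : br 0 = 0 := by simp [br]

/-- The multi-indices `γ` with `[γ] ≥ 0` or `γ = e_n` for some `n ≠ 0`. -/
def InT (γ : MI) : Prop :=
  0 ≤ br γ ∨ ∃ n, γ = Finsupp.single (Sum.inr n) 1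

/-- `T*` as a subspace of `ℝ[[z_k, z_n]]`: the direct product over the multi-indices of `T`. -/
def TstarSpace : Submodule ℝ PS where
  carrier := {f | ∀ γ, coeff γ f ≠ 0 → InT γ}
  zero_mem' := fun γ h => absurd (map_zero _) h
  add_mem' {f g} hf hg γ h := by
    rw [map_add] at h
    by_cases h0 : coeff γ f = 0
    · rw [h0, zero_add] at h; exact hg γ h
    · exact hf γ h0
  smul_mem' c f hf γ h := hf γ fun h0 => h (by rw [coeff_smul, h0, mul_zero])

/-- The index set of `T`. -/
abbrev TIdx := {γ : MI // InT γ}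

/-- `T`, with basis `z_β`. -/
abbrev T := TIdx →₀ ℝ

/-- The basis element `z_β` of `T`. -/
def zT (β : TIdx) : T := Finsupp.single β 1

/-- The data `α > 0` and an additive `|·| : ℕ₀² → ℝ` with `|(1,0)|, |(0,1)| > 0`. -/
structure Scaling where
  α : ℝ
  α_pos : 0 < α
  len : N2 →+ ℝ
  len_unit_pos : ∀ i, 0 < len (unit i)

namespace Scaling
variable (P : Scaling)

/-- `∑_(n ≠ 0) |n| γ(n)` -/
def pw (γ : MI) : ℝ := γ.sum fun v k => (k : ℝ) * Sum.elim (fun _ => 0) (fun n => P.len n.1) v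

theorem pw_add (γ δ : MI) : P.pw (γ + δ) = P.pw γ + P.pw δ :=
  Finsupp.sum_add_index' (by simp) fun _ _ _ => by push_cast; ring

@[simp] theorem pw_single_inl (k : ℕ) : P.pw (Finsupp.single (Sum.inl k) 1) = 0 := by simp [pw]
@[simp] theorem pw_single_inr (m) : P.pw (Finsupp.single (Sum.inr m) 1) = P.len m.1 := by simp [pw]
@[simp] theorem pw_single_varAdd (n i) :
    P.pw (Finsupp.single (varAdd n i) 1) = P.len n + P.len (unit i) := by
  rw [varAdd, pw_single_inr, map_add]
@[simp] theorem pw_zero : P.pw 0 = 0 := by simp [pw]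

/-- The homogeneity `|γ| = α ([γ] + 1) + ∑_(n ≠ 0) |n| γ(n)`. -/
def hom (γ : MI) : ℝ := P.α * ((br γ : ℝ) + 1) + P.pw γ

theorem step_tilt {n : N2} {γ β : MI} (h : Step tiltExp (tiltCoef n) γ β) :
    br β = br γ + 1 ∧ P.pw β + P.len n = P.pw γ := by
  obtain ⟨i, -, hc, hβ⟩ := h
  have h1 := congrArg br hβ
  have h2 := congrArg P.pw hβ
  rw [br_add, br_add] at h1
  rw [pw_add, pw_add] at h2
  rcases i with k | m
  · have hn : n = 0 := by by_contra hn; exact hc (if_neg hn)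
    subst hn
    simp only [tiltExp, br_single_inl, pw_single_inl, map_zero] at *
    push_cast at h1
    exact ⟨by lia, by linarith⟩
  · have hn : m.1 = n := by by_contra hn; exact hc (if_neg hn)
    subst hn
    simp only [tiltExp, br_single_inr, pw_single_inr, br_zero, pw_zero] at *
    exact ⟨by lia, by linarith⟩

theorem step_shift {i : Fin 2} {γ β : MI} (h : Step (shiftExp i) (shiftCoef i) γ β) :
    br β = br γ ∧ P.pw β = P.pw γ + P.len (unit i) := by
  obtain ⟨v, -, hc, hβ⟩ := h
  have h1 := congrArg br hβ
  have h2 := congrArg P.pw hβ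
  rw [br_add, br_add] at h1
  rw [pw_add, pw_add] at h2
  rcases v with k | m
  · simp only [shiftExp, br_add, pw_add, br_single_inl, pw_single_inl, br_single_varAdd,
      pw_single_varAdd, map_zero] at *
    push_cast at h1
    exact ⟨by lia, by linarith⟩
  · simp only [shiftExp, br_single_inr, pw_single_inr, br_single_varAdd, pw_single_varAdd] at *
    exact ⟨by lia, by linarith⟩

/-- The pairs `(γ, n)` with `[γ] ≥ 0` and `|γ| > |n|`. -/
def Adm (γ : MI) (n : N2) : Prop := 0 ≤ br γ ∧ P.len n < P.hom γ

/-- The span of the `z^γ D^(n)` with `(γ, n)` admissible and of `∂_1`, `∂_2`. -/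
def LSpan : Submodule ℝ (Derivation ℝ PS PS) :=
  Submodule.span ℝ (Set.range shift ∪ {D | ∃ γ n, P.Adm γ n ∧ D = mon γ • tilt n})

/-- The span of the `z^γ` with `(γ, n)` admissible. -/
def VSpan (n : N2) : Submodule ℝ PS := Submodule.span ℝ {f | ∃ γ, P.Adm γ n ∧ f = mon γ}

theorem mon_mem_VSpan {γ : MI} {n : N2} (h : P.Adm γ n) : mon γ ∈ P.VSpan n :=
  Submodule.subset_span ⟨γ, h, rfl⟩

theorem smul_tilt_mem_LSpan {n : N2} {f : PS} (hf : f ∈ P.VSpan n) : f • tilt n ∈ P.LSpan := by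
  induction hf using Submodule.span_induction with
  | mem f hf =>
    obtain ⟨γ, h, rfl⟩ := hf
    exact Submodule.subset_span (Or.inr ⟨γ, n, h, rfl⟩)
  | zero => rw [zero_smul]; exact zero_mem _
  | add f g _ _ hf hg => rw [add_smul]; exact add_mem hf hg
  | smul c f _ hf => rw [smul_assoc]; exact Submodule.smul_mem _ c hf

/-- `(γ, n)` admissible implies `(γ, m)` admissible if `|m| ≤ |n|`. -/
theorem Adm.mono {γ : MI} {n m : N2} (h : P.Adm γ n) (hm : P.len m ≤ P.len n) : P.Adm γ m :=
  ⟨h.1, hm.trans_lt h.2⟩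

theorem adm_step_shift {i : Fin 2} {γ β : MI} {n : N2} (hγ : P.Adm γ n)
    (h : Step (shiftExp i) (shiftCoef i) γ β) : P.Adm β n := by
  obtain ⟨h1, h2⟩ := P.step_shift h
  have := P.len_unit_pos i
  refine ⟨by rw [h1]; exact hγ.1, hγ.2.trans ?_⟩
  rw [hom, hom, h1, h2]
  linarith

theorem adm_step_tilt {g γ β : MI} {m n : N2} (hg : P.Adm g m) (hγ : P.Adm γ n)
    (h : Step tiltExp (tiltCoef m) γ β) : P.Adm (g + β) n := by
  obtain ⟨h1, h2⟩ := P.step_tilt h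
  have hg2 := hg.2
  refine ⟨by rw [br_add, h1]; have := hg.1; have := hγ.1; lia, hγ.2.trans ?_⟩
  rw [hom] at *
  rw [hom, br_add, pw_add, h1]
  push_cast
  linarith

theorem shift_mem_VSpan {i : Fin 2} {n : N2} {f : PS} (hf : f ∈ P.VSpan n) :
    shift i f ∈ P.VSpan n := by
  induction hf using Submodule.span_induction with
  | mem f hf =>
    obtain ⟨γ, h, rfl⟩ := hf
    have := vectorField_monomial_mem_span (shift_locFin i) (γ := γ) (W := P.VSpan n) (g := 0)
      fun β hβ => by rw [zero_add]; exact P.mon_mem_VSpan (P.adm_step_shift h hβ)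
    rwa [monomial_zero_one, one_mul] at this
  | zero => rw [map_zero]; exact zero_mem _
  | add f g _ _ hf hg => rw [map_add]; exact add_mem hf hg
  | smul c f _ hf => rw [Derivation.map_smul]; exact Submodule.smul_mem _ c hf

theorem tilt_mem_VSpan {g : MI} {m n : N2} (hg : P.Adm g m) {f : PS} (hf : f ∈ P.VSpan n) :
    mon g * tilt m f ∈ P.VSpan n := by
  induction hf using Submodule.span_induction with
  | mem f hf =>
    obtain ⟨γ, h, rfl⟩ := hf
    exact vectorField_monomial_mem_span (tilt_locFin m) fun β hβ =>
      P.mon_mem_VSpan (P.adm_step_tilt hg h hβ)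
  | zero => rw [map_zero, mul_zero]; exact zero_mem _
  | add f g _ _ hf hg => rw [map_add, mul_add]; exact add_mem hf hg
  | smul c f _ hf => rw [Derivation.map_smul, mul_smul_comm]; exact Submodule.smul_mem _ c hf

theorem lie_gen_gen {D D' : Derivation ℝ PS PS}
    (hD : D ∈ Set.range shift ∪ {D | ∃ γ n, P.Adm γ n ∧ D = mon γ • tilt n})
    (hD' : D' ∈ Set.range shift ∪ {D | ∃ γ n, P.Adm γ n ∧ D = mon γ • tilt n}) :
    ⁅D, D'⁆ ∈ P.LSpan := by
  have h1 : ∀ (γ n i), P.Adm γ n → ⁅mon γ • tilt n, shift i⁆ ∈ P.LSpan := by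
    intro γ n i h
    have := lie_smul_smul (mon γ) 1 (tilt n) (shift i)
    rw [one_smul, Derivation.map_one_eq_zero, mul_zero, zero_smul, zero_sub, one_mul, mul_one,
      lie_tilt_shift] at this
    rw [this]
    refine add_mem (neg_mem (P.smul_tilt_mem_LSpan (P.shift_mem_VSpan (P.mon_mem_VSpan h)))) ?_
    rw [smul_comm]
    refine Submodule.smul_mem _ _ ?_
    by_cases h0 : n i = 0
    · have : n - unit i = n := by
        funext j
        simp only [Pi.sub_apply, unit, Pi.single_apply]
        split_ifs with hj
        · subst hj; lia
        · lia
      rw [this]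
      exact P.smul_tilt_mem_LSpan (P.mon_mem_VSpan h)
    · refine P.smul_tilt_mem_LSpan (P.mon_mem_VSpan (Adm.mono P h ?_))
      have hle : unit i ≤ n := by
        intro j
        simp only [unit, Pi.single_apply]
        split_ifs with hj
        · subst hj; lia
        · lia
      have := congrArg P.len (tsub_add_cancel_of_le hle)
      rw [map_add] at this
      have := P.len_unit_pos i
      linarith
  rcases hD with ⟨i, rfl⟩ | ⟨γ, n, h, rfl⟩ <;> rcases hD' with ⟨j, rfl⟩ | ⟨γ', n', h', rfl⟩
  · rw [lie_shift_shift]; exact zero_mem _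
  · rw [← lie_skew]; exact neg_mem (h1 _ _ _ h')
  · exact h1 _ _ _ h
  · rw [lie_smul_smul, lie_tilt_tilt, smul_zero, add_zero]
    exact sub_mem (P.smul_tilt_mem_LSpan (P.tilt_mem_VSpan h (P.mon_mem_VSpan h')))
      (P.smul_tilt_mem_LSpan (P.tilt_mem_VSpan h' (P.mon_mem_VSpan h)))

theorem lie_mem_LSpan {x y : Derivation ℝ PS PS} (hx : x ∈ P.LSpan) (hy : y ∈ P.LSpan) :
    ⁅x, y⁆ ∈ P.LSpan := by
  induction hx using Submodule.span_induction with
  | mem x hx =>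
    induction hy using Submodule.span_induction with
    | mem y hy => exact P.lie_gen_gen hx hy
    | zero =>
      have h : ⁅x, (0 : Derivation ℝ PS PS)⁆ = 0 := lie_zero x
      rw [h]; exact zero_mem _
    | add y z _ _ hy hz => exact (lie_add x y z : ⁅x, y + z⁆ = ⁅x, y⁆ + ⁅x, z⁆) ▸ add_mem hy hz
    | smul c y _ hy =>
      exact (lie_smul c x y : ⁅x, c • y⁆ = c • ⁅x, y⁆) ▸ Submodule.smul_mem _ c hy
  | zero =>
    have h : ⁅(0 : Derivation ℝ PS PS), y⁆ = 0 := zero_lie y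
    rw [h]; exact zero_mem _
  | add x z _ _ hx hz => exact (add_lie x z y : ⁅x + z, y⁆ = ⁅x, y⁆ + ⁅z, y⁆) ▸ add_mem hx hz
  | smul c x _ hx =>
    exact (smul_lie c x y : ⁅c • x, y⁆ = c • ⁅x, y⁆) ▸ Submodule.smul_mem _ c hx

/-- The Lie algebra `L` spanned by the `z^γ D^(n)` with `[γ] ≥ 0`, `|γ| > |n|`, and by `∂_1`, `∂_2`,
with the commutator of derivations. -/
def L : LieSubalgebra ℝ (Derivation ℝ PS PS) where
  __ := P.LSpan
  lie_mem' hx hy := P.lie_mem_LSpan hx hy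

/-- A subspace of `ℝ[[z]]` invariant under the generators of `L` is an `L`-module. -/
def mkModule (W : Submodule ℝ PS) (hs : ∀ i, ∀ f ∈ W, shift i f ∈ W)
    (ht : ∀ γ n, P.Adm γ n → ∀ f ∈ W, mon γ * tilt n f ∈ W) : LieSubmodule ℝ P.L PS where
  __ := W
  lie_mem {x f} hf := by
    obtain ⟨D, hD⟩ := x
    change f ∈ W at hf
    change D f ∈ W
    change D ∈ P.LSpan at hD
    induction hD using Submodule.span_induction with
    | mem D hD =>
      rcases hD with ⟨i, rfl⟩ | ⟨γ, n, h, rfl⟩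
      · exact hs i f hf
      · exact ht γ n h f hf
    | zero => exact zero_mem _
    | add x z _ _ hx hz => exact add_mem hx hz
    | smul c x _ hx => exact Submodule.smul_mem _ c hx

/-- `T*` as a module over `L`. -/
def Tstar : LieSubmodule ℝ P.L PS :=
  P.mkModule TstarSpace
    (fun i f hf β hβ => by
      obtain ⟨γ, h0, hst⟩ := exists_step (shift_locFin i) hβ
      rcases hf γ h0 with h | ⟨n, rfl⟩
      · left; rw [(P.step_shift hst).1]; exact h
      · right
        obtain ⟨v, hv, -, hs⟩ := hst
        rw [Finsupp.single_apply] at hv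
        have hv : Sum.inr n = v := by by_contra h; exact hv (if_neg h)
        subst hv
        rw [add_comm] at hs
        exact ⟨_, add_left_cancel hs⟩)
    (fun g m hg f hf β hβ => by
      rw [mon, coeff_monomial_mul, one_mul] at hβ
      split_ifs at hβ with hle
      · obtain ⟨γ, h0, hst⟩ := exists_step (tilt_locFin m) hβ
        have h1 := (P.step_tilt hst).1
        have h2 : br β = br (β - g) + br g := by rw [← br_add, tsub_add_cancel_of_le hle]
        left
        have := hg.1
        rcases hf γ h0 with h | ⟨n, rfl⟩
        · lia
        · rw [br_single_inr] at h1; lia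
      · exact absurd rfl hβ)

/-- `span {z^γ : (γ, n) admissible}` as a module over `L`. -/
def V (n : N2) : LieSubmodule ℝ P.L PS :=
  P.mkModule (P.VSpan n) (fun _ _ hf => P.shift_mem_VSpan hf)
    (fun _ _ hg _ hf => P.tilt_mem_VSpan hg hf)

/-- The universal enveloping algebra `U(L)`. -/
abbrev U := UniversalEnvelopingAlgebra ℝ P.L

attribute [local instance 100] LieRing.ofAssociativeRing

/-- The algebra morphism `ρ : U(L) → End(T*)` extending the action of `L` on `T*`. -/
def rho : P.U →ₐ[ℝ] Module.End ℝ P.Tstar :=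
  UniversalEnvelopingAlgebra.lift ℝ (LieModule.toEnd ℝ P.L P.Tstar)

/-- `v ↦ v D^(n)` as a map into `L`. -/
def tiltL (n : N2) : P.V n →ₗ[ℝ] P.L where
  toFun v := ⟨v.1 • tilt n, P.smul_tilt_mem_LSpan v.2⟩
  map_add' v w := Subtype.ext (add_smul v.1 w.1 (tilt n))
  map_smul' c v := Subtype.ext (smul_assoc c v.1 (tilt n))

/-- `L` acts on linear maps `F` from `V n` to `U(L)` by `(D • F)(v) = D F(v) - F(D v)`. -/
def insAct (n : N2) : P.L →ₗ⁅ℝ⁆ Module.End ℝ (P.V n →ₗ[ℝ] P.U) where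
  toFun x :=
    { toFun := fun F => LinearMap.mulLeft ℝ (UniversalEnvelopingAlgebra.ι ℝ x) ∘ₗ F
        - F ∘ₗ LieModule.toEnd ℝ P.L (P.V n) x
      map_add' := fun F G => by ext v; simp [mul_add]; abel
      map_smul' := fun c F => by ext v; simp [smul_sub] }
  map_add' x y := by
    ext F v
    simp [add_mul]; abel
  map_smul' c x := by
    ext F v
    simp [smul_sub]
  map_lie' {x y} := by
    ext F v
    simp [LieRing.of_associative_ring_bracket, mul_sub, sub_mul, mul_assoc]
    abel

/-- The map `u ↦ (v ↦ v u D^(n))` from `U(L)`, determined by `v 1 D^(n) = v D^(n)` and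
`v (D u) D^(n) = D (v u D^(n)) - (D v) u D^(n)` for `D ∈ L`; see the two lemmas below. -/
def insLin (n : N2) : P.U →ₗ[ℝ] (P.V n →ₗ[ℝ] P.U) where
  toFun u := UniversalEnvelopingAlgebra.lift ℝ (P.insAct n) u
    ((UniversalEnvelopingAlgebra.ι ℝ : P.L →ₗ⁅ℝ⁆ P.U).toLinearMap ∘ₗ P.tiltL n)
  map_add' u u' := by rw [map_add]; rfl
  map_smul' c u := by rw [map_smul]; rfl

theorem insLin_one (n : N2) (v : P.V n) :
    P.insLin n 1 v = UniversalEnvelopingAlgebra.ι ℝ (P.tiltL n v) := by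
  simp [insLin]

theorem insLin_ι_mul (n : N2) (x : P.L) (u : P.U) (v : P.V n) :
    P.insLin n (UniversalEnvelopingAlgebra.ι ℝ x * u) v
      = UniversalEnvelopingAlgebra.ι ℝ x * P.insLin n u v - P.insLin n u ⁅x, v⁆ := by
  simp [insLin, insAct]

theorem U_induction {p : P.U → Prop} (add : ∀ u w, p u → p w → p (u + w))
    (smul : ∀ (c : ℝ) u, p u → p (c • u)) (one : p 1)
    (mul : ∀ (x : P.L) u, p u → p (UniversalEnvelopingAlgebra.ι ℝ x * u)) (u : P.U) : p u := by
  let S : Subalgebra ℝ P.U :=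
    { carrier := {u | ∀ w, p w → p (u * w)}
      mul_mem' := fun {a b} ha hb w hw => by rw [mul_assoc]; exact ha _ (hb _ hw)
      add_mem' := fun {a b} ha hb w hw => by rw [add_mul]; exact add _ _ (ha _ hw) (hb _ hw)
      algebraMap_mem' := fun c w hw => by rw [← Algebra.smul_def]; exact smul c _ hw }
  let f : P.L →ₗ⁅ℝ⁆ S :=
    { toFun := fun x => ⟨UniversalEnvelopingAlgebra.ι ℝ x, fun w hw => mul x w hw⟩
      map_add' := fun x y => Subtype.ext (map_add _ x y)
      map_smul' := fun c x => Subtype.ext (map_smul _ c x)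
      map_lie' := fun {x y} => Subtype.ext (LieHom.map_lie _ x y) }
  have h : S.val.comp (UniversalEnvelopingAlgebra.lift ℝ f) = AlgHom.id ℝ P.U := by
    apply UniversalEnvelopingAlgebra.hom_ext
    ext x
    simp [f]
  have h2 := (UniversalEnvelopingAlgebra.lift ℝ f u).2 1 one
  have h3 : ((UniversalEnvelopingAlgebra.lift ℝ f u : S) : P.U) = u := DFunLike.congr_fun h u
  rwa [h3, mul_one] at h2

theorem insLin_comm (n n' : N2) (u : P.U) : ∀ (v : P.V n) (v' : P.V n'),
    P.insLin n' (P.insLin n u v) v' = P.insLin n (P.insLin n' u v') v := by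
  induction u using P.U_induction with
  | add u w hu hw => intro v v'; simp [hu, hw]
  | smul c u hu => intro v v'; simp [hu]
  | one =>
    intro v v'
    have key : ∀ (n n' : N2) (v : P.V n) (v' : P.V n'),
        P.insLin n' (UniversalEnvelopingAlgebra.ι ℝ (P.tiltL n v)) v'
          = UniversalEnvelopingAlgebra.ι ℝ (P.tiltL n v) * UniversalEnvelopingAlgebra.ι ℝ (P.tiltL n' v')
            - UniversalEnvelopingAlgebra.ι ℝ (P.tiltL n' ⁅P.tiltL n v, v'⁆) := by
      intro n n' v v'
      have := P.insLin_ι_mul n' (P.tiltL n v) 1 v'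
      rwa [mul_one, insLin_one, insLin_one] at this
    rw [insLin_one, insLin_one, key, key]
    have hl : ⁅P.tiltL n v, P.tiltL n' v'⁆
        = P.tiltL n' ⁅P.tiltL n v, v'⁆ - P.tiltL n ⁅P.tiltL n' v', v⁆ := by
      apply Subtype.ext
      have := lie_smul_smul v.1 v'.1 (tilt n) (tilt n')
      rw [lie_tilt_tilt, smul_zero, add_zero] at this
      exact this
    have h2 := congrArg (UniversalEnvelopingAlgebra.ι ℝ : P.L →ₗ⁅ℝ⁆ P.U) hl
    rw [LieHom.map_lie, map_sub, LieRing.of_associative_ring_bracket] at h2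
    exact sub_eq_sub_iff_sub_eq_sub.2 h2
  | mul x u hu =>
    intro v v'
    simp only [insLin_ι_mul, map_sub, LinearMap.sub_apply, hu]
    abel

/-- The pairs `(γ, n)` with `[γ] ≥ 0` and `|γ| > |n|`. -/
abbrev Pair := {p : MI × N2 // P.Adm p.1 p.2}

/-- The index set of the basis `{z^γ D^(n)} ∪ {∂_i}` of `L`. -/
abbrev LIdx := P.Pair ⊕ Fin 2

/-- The multi-indices `K = (J, m)` over the index set of `L`: `J (γ, n) = K (Sum.inl (γ, n))` and
`m i = K (Sum.inr i)`. -/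
abbrev JM := P.LIdx →₀ ℕ

/-- The map `u ↦ z^γ u D^(n)` on `U(L)`. -/
def ins (p : P.Pair) : Module.End ℝ P.U :=
  (P.insLin p.1.2).flip ⟨mon p.1.1, P.mon_mem_VSpan p.2⟩

theorem ins_commute (p q : P.Pair) : Commute (P.ins p) (P.ins q) := by
  ext u
  exact P.insLin_comm _ _ u _ _

/-- `∂_i` as an element of `U(L)`. -/
def shiftU (i : Fin 2) : P.U :=
  UniversalEnvelopingAlgebra.ι ℝ (⟨shift i, Submodule.subset_span (Or.inl ⟨i, rfl⟩)⟩ : P.L)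

/-- The element `D_(J,m)` of `U(L)`: apply the commuting maps `u ↦ z^γ u D^(n)`, each `J(γ,n)` times,
to `∂_1^(m_1) ∂_2^(m_2)`, and divide by `J! m!`. -/
def DJM (K : P.JM) : P.U :=
  (K.prod fun _ k => (k.factorial : ℝ))⁻¹ •
    ((K.comapDomain Sum.inl Sum.inl_injective.injOn).support.noncommProd
      (fun p => P.ins p ^ K (Sum.inl p)) fun p _ q _ _ => (P.ins_commute p q).pow_pow _ _)
      (P.shiftU 0 ^ K (Sum.inr 0) * P.shiftU 1 ^ K (Sum.inr 1))

/-- `T⁺`, the polynomial algebra with variables indexed by the index set of `L`. -/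
abbrev Tplus := MvPolynomial P.LIdx ℝ

/-- The basis element `Z^(J,m)` of `T⁺`. -/
def Z (K : P.JM) : P.Tplus := MvPolynomial.monomial K 1

/-- The monomial `z^γ` as an element of `T*`. -/
def monT (γ : TIdx) : P.Tstar :=
  ⟨mon γ.1, fun δ h => by rw [eq_of_coeff_monomial_ne_zero h]; exact γ.2⟩

/-- The matrix entry `(D_(J,m))_β^γ` of `ρ D_(J,m)`. -/
def moduleCoeff (β : TIdx) (K : P.JM) (γ : TIdx) : ℝ :=
  coeff β.1 (P.rho (P.DJM K) (P.monT γ) : PS)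

/-- `Δ z_β = ∑ (D_(J,m))_β^γ Z^(J,m) ⊗ z_γ`. -/
def Delta : T →ₗ[ℝ] P.Tplus ⊗[ℝ] T :=
  Finsupp.linearCombination ℝ fun β =>
    ∑ᶠ p : P.JM × TIdx, P.moduleCoeff β p.1 p.2 • (P.Z p.1 ⊗ₜ[ℝ] zT p.2)

variable {P}

/-- The structure constants of the product of `U(L)` in a basis `b`. -/
def productCoeff (b : Module.Basis P.JM ℝ P.U) (K K' K'' : P.JM) : ℝ := b.repr (b K' * b K'') K

/-- `Δ⁺ Z^K = ∑ c Z^K' ⊗ Z^K''` over all `K'`, `K''`, where `c` is the coefficient of `b K` in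
`b K' * b K''`. -/
def DeltaPlus (b : Module.Basis P.JM ℝ P.U) : P.Tplus →ₗ[ℝ] P.Tplus ⊗[ℝ] P.Tplus :=
  (MvPolynomial.basisMonomials P.LIdx ℝ).constr ℝ fun K =>
    ∑ᶠ p : P.JM × P.JM, productCoeff b K p.1 p.2 • (P.Z p.1 ⊗ₜ[ℝ] P.Z p.2)

variable (P)

/-- The counit of `T⁺`, dual to the unit of `U(L)`: `ε(Z^(J,m)) = 1` if `(J,m) = 0`, else `0`. -/
def counit : P.Tplus →ₗ[ℝ] ℝ := MvPolynomial.lcoeff ℝ 0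

end Scaling

/-- `comul`, `counit` and `antipode` make the algebra `A` a Hopf algebra. -/
structure IsHopfAlgebra {A : Type*} [CommRing A] [Algebra ℝ A] (comul : A →ₗ[ℝ] A ⊗[ℝ] A)
    (counit : A →ₗ[ℝ] ℝ) (antipode : A →ₗ[ℝ] A) : Prop where
  coassoc : TensorProduct.assoc ℝ A A A ∘ₗ comul.rTensor A ∘ₗ comul = comul.lTensor A ∘ₗ comul
  rTensor_counit_comp_comul : counit.rTensor A ∘ₗ comul = TensorProduct.mk ℝ ℝ A 1
  lTensor_counit_comp_comul : counit.lTensor A ∘ₗ comul = (TensorProduct.mk ℝ A ℝ).flip 1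
  counit_one : counit 1 = 1
  counit_mul : ∀ a b, counit (a * b) = counit a * counit b
  comul_one : comul 1 = 1
  comul_mul : ∀ a b, comul (a * b) = comul a * comul b
  mul_antipode_rTensor_comul :
    LinearMap.mul' ℝ A ∘ₗ antipode.rTensor A ∘ₗ comul = Algebra.linearMap ℝ A ∘ₗ counit
  mul_antipode_lTensor_comul :
    LinearMap.mul' ℝ A ∘ₗ antipode.lTensor A ∘ₗ comul = Algebra.linearMap ℝ A ∘ₗ counit

/-- The Hopf algebra of Mathlib that the data above define. -/
@[reducible]
def IsHopfAlgebra.toHopfAlgebra {A : Type*} [CommRing A] [Algebra ℝ A]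
    {comul : A →ₗ[ℝ] A ⊗[ℝ] A} {counit : A →ₗ[ℝ] ℝ} {antipode : A →ₗ[ℝ] A}
    (h : IsHopfAlgebra comul counit antipode) : HopfAlgebra ℝ A where
  comul := comul
  counit := counit
  coassoc := h.coassoc
  rTensor_counit_comp_comul := h.rTensor_counit_comp_comul
  lTensor_counit_comp_comul := h.lTensor_counit_comp_comul
  counit_one := h.counit_one
  mul_compr₂_counit := by ext a b; exact h.counit_mul a b
  comul_one := h.comul_one
  mul_compr₂_comul := by ext a b; exact h.comul_mul a b
  antipode := antipode
  mul_antipode_rTensor_comul := h.mul_antipode_rTensor_comul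
  mul_antipode_lTensor_comul := h.mul_antipode_lTensor_comul

/-- `coact` makes `M` a left comodule over the coalgebra `A`. -/
structure IsLeftComodule {A M : Type*} [CommRing A] [Algebra ℝ A] [AddCommGroup M] [Module ℝ M]
    (comul : A →ₗ[ℝ] A ⊗[ℝ] A) (counit : A →ₗ[ℝ] ℝ) (coact : M →ₗ[ℝ] A ⊗[ℝ] M) : Prop where
  coassoc : coact.lTensor A ∘ₗ coact = TensorProduct.assoc ℝ A A M ∘ₗ comul.rTensor M ∘ₗ coact
  counit_coact : counit.rTensor M ∘ₗ coact = TensorProduct.mk ℝ ℝ M 1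

end MultiIndexHopf
end

open MvPowerSeries
open scoped TensorProduct

noncomputable section
namespace MultiIndexHopf
namespace Scaling
attribute [local instance 100] LieRing.ofAssociativeRing
variable (P : Scaling)

/-- The inclusion of `L` into `U(L)`. -/
abbrev toU : P.L →ₗ⁅ℝ⁆ P.U := UniversalEnvelopingAlgebra.ι ℝ

/-- The coproduct of `U(L)`, for which the elements of `L` are primitive. -/
def comulU : P.U →ₐ[ℝ] P.U ⊗[ℝ] P.U :=
  UniversalEnvelopingAlgebra.lift ℝ
    { toFun := fun x => P.toU x ⊗ₜ[ℝ] 1 + 1 ⊗ₜ[ℝ] P.toU x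
      map_add' := fun x y => by
        simp only [map_add, TensorProduct.add_tmul, TensorProduct.tmul_add]; abel
      map_smul' := fun c x => by
        simp only [map_smul, TensorProduct.smul_tmul', TensorProduct.tmul_smul, smul_add,
          RingHom.id_apply]
      map_lie' := fun {x y} => by
        simp only [LieHom.map_lie, LieRing.of_associative_ring_bracket, mul_add, add_mul,
          Algebra.TensorProduct.tmul_mul_tmul, one_mul, mul_one, TensorProduct.sub_tmul,
          TensorProduct.tmul_sub]
        abel }

theorem comulU_toU (x : P.L) : P.comulU (P.toU x) = P.toU x ⊗ₜ[ℝ] 1 + 1 ⊗ₜ[ℝ] P.toU x := by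
  rw [comulU, UniversalEnvelopingAlgebra.lift_ι_apply]
  rfl

/-- The counit of `U(L)`, which vanishes on `L`. -/
def counitU : P.U →ₐ[ℝ] ℝ := UniversalEnvelopingAlgebra.lift ℝ (0 : P.L →ₗ⁅ℝ⁆ ℝ)

@[simp] theorem counitU_toU (x : P.L) : P.counitU (P.toU x) = 0 := by
  rw [counitU, toU, UniversalEnvelopingAlgebra.lift_ι_apply]
  rfl

/-- The antipode of `U(L)` with values in the opposite algebra. -/
def antipodeOp : P.U →ₐ[ℝ] P.Uᵐᵒᵖ :=
  UniversalEnvelopingAlgebra.lift ℝ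
    { toFun := fun x => MulOpposite.op (-P.toU x)
      map_add' := fun x y => by rw [map_add, neg_add, MulOpposite.op_add]
      map_smul' := fun c x => by rw [map_smul, ← smul_neg, MulOpposite.op_smul]; rfl
      map_lie' := fun {x y} => by
        simp only [LieHom.map_lie, LieRing.of_associative_ring_bracket, ← MulOpposite.op_mul,
          neg_mul_neg, neg_sub, MulOpposite.op_sub] }

/-- The antipode of `U(L)`: the antimorphism with `x ↦ -x` for `x ∈ L`. -/
def antipodeU : P.U →ₗ[ℝ] P.U :=
  (MulOpposite.opLinearEquiv ℝ).symm.toLinearMap ∘ₗ P.antipodeOp.toLinearMap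

theorem antipodeU_one : P.antipodeU 1 = 1 := by simp [antipodeU]

theorem antipodeU_mul (u v : P.U) : P.antipodeU (u * v) = P.antipodeU v * P.antipodeU u := by
  simp [antipodeU]

theorem antipodeU_toU (x : P.L) : P.antipodeU (P.toU x) = -P.toU x := by
  simp only [antipodeU, antipodeOp, toU, LinearMap.comp_apply, AlgHom.toLinearMap_apply,
    UniversalEnvelopingAlgebra.lift_ι_apply]
  rfl

theorem comulU_antipodeU (u : P.U) :
    P.comulU (P.antipodeU u) = TensorProduct.map P.antipodeU P.antipodeU (P.comulU u) := by
  induction u using P.U_induction with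
  | add u w hu hw => simp only [map_add, hu, hw]
  | smul c u hu => simp only [map_smul, hu]
  | one => simp [antipodeU_one, Algebra.TensorProduct.one_def]
  | mul x u hu =>
    rw [antipodeU_mul, map_mul, map_mul, hu, antipodeU_toU, map_neg, comulU_toU]
    induction P.comulU u using TensorProduct.induction_on with
    | zero => simp
    | add a b ha hb => rw [map_add, add_mul, mul_add, map_add, ha, hb]
    | tmul a b =>
      simp only [add_mul, mul_add, mul_neg, Algebra.TensorProduct.tmul_mul_tmul, one_mul, mul_one,
        map_add, TensorProduct.map_tmul, antipodeU_mul, antipodeU_toU, TensorProduct.neg_tmul,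
        TensorProduct.tmul_neg]
      abel

theorem mul_antipodeU_rTensor (u : P.U) :
    LinearMap.mul' ℝ P.U (P.antipodeU.rTensor P.U (P.comulU u)) = P.counitU u • 1 := by
  induction u using P.U_induction with
  | add u w hu hw => simp only [map_add, hu, hw, add_smul]
  | smul c u hu => simp only [map_smul, hu, smul_assoc]
  | one => simp [antipodeU_one, Algebra.TensorProduct.one_def]
  | mul x u hu =>
    rw [map_mul P.comulU, map_mul P.counitU, counitU_toU, zero_mul, zero_smul, comulU_toU]
    induction P.comulU u using TensorProduct.induction_on with
    | zero => simp
    | add a b ha hb => rw [mul_add, map_add, map_add, ha, hb, add_zero]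
    | tmul a b =>
      simp [-UniversalEnvelopingAlgebra.ι_apply, add_mul, antipodeU_mul, antipodeU_toU, mul_assoc]

theorem mul_antipodeU_lTensor (u : P.U) :
    LinearMap.mul' ℝ P.U (P.antipodeU.lTensor P.U (P.comulU u)) = P.counitU u • 1 := by
  induction u using P.U_induction with
  | add u w hu hw => simp only [map_add, hu, hw, add_smul]
  | smul c u hu => simp only [map_smul, hu, smul_assoc]
  | one => simp [antipodeU_one, Algebra.TensorProduct.one_def]
  | mul x u hu =>
    rw [map_mul P.comulU, map_mul P.counitU, counitU_toU, zero_mul, zero_smul, comulU_toU]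
    have key : ∀ t : P.U ⊗[ℝ] P.U, LinearMap.mul' ℝ P.U (P.antipodeU.lTensor P.U
        ((P.toU x ⊗ₜ[ℝ] 1 + 1 ⊗ₜ[ℝ] P.toU x) * t))
        = P.toU x * LinearMap.mul' ℝ P.U (P.antipodeU.lTensor P.U t)
          - LinearMap.mul' ℝ P.U (P.antipodeU.lTensor P.U t) * P.toU x := by
      intro t
      induction t using TensorProduct.induction_on with
      | zero => simp
      | add a b ha hb => rw [mul_add, map_add, map_add, ha, hb, map_add, map_add, mul_add, add_mul]; abel
      | tmul a b =>
      simp [-UniversalEnvelopingAlgebra.ι_apply, add_mul, antipodeU_mul, antipodeU_toU, mul_assoc,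
          sub_eq_add_neg]
    rw [key, hu]
    simp

/-- The two-sided extension of an endomorphism `A` to a tensor square as a derivation. -/
def bothSides (A : Module.End ℝ P.U) : Module.End ℝ (P.U ⊗[ℝ] P.U) :=
  A.rTensor P.U + A.lTensor P.U

@[simp] theorem bothSides_tmul (A : Module.End ℝ P.U) (u v : P.U) :
    P.bothSides A (u ⊗ₜ v) = A u ⊗ₜ v + u ⊗ₜ A v := by simp [bothSides]

theorem comulU_toU_mul (x : P.L) (u : P.U) :
    P.comulU (P.toU x * u) = P.bothSides (LinearMap.mulLeft ℝ (P.toU x)) (P.comulU u) := by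
  rw [map_mul, comulU_toU]
  induction P.comulU u using TensorProduct.induction_on with
  | zero => simp
  | add a b ha hb => rw [mul_add, map_add, ha, hb]
  | tmul a b => simp [add_mul]

theorem comulU_insLin (n : N2) (u : P.U) : ∀ v : P.V n,
    P.comulU (P.insLin n u v) = P.bothSides ((P.insLin n).flip v) (P.comulU u) := by
  induction u using P.U_induction with
  | add u w hu hw => intro v; simp only [map_add, LinearMap.add_apply, hu, hw]
  | smul c u hu => intro v; simp only [map_smul, LinearMap.smul_apply, hu]
  | one =>
    intro v
    rw [insLin_one, comulU_toU, map_one, Algebra.TensorProduct.one_def, bothSides_tmul]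
    simp [insLin_one]
  | mul x u hu =>
    intro v
    rw [insLin_ι_mul, map_sub, comulU_toU_mul, comulU_toU_mul, hu, hu]
    induction P.comulU u using TensorProduct.induction_on with
    | zero => simp
    | add a b ha hb => simp only [map_add, ← ha, ← hb]; abel
    | tmul a b =>
      simp only [bothSides_tmul, map_add, LinearMap.flip_apply, LinearMap.mulLeft_apply,
        insLin_ι_mul, TensorProduct.sub_tmul, TensorProduct.tmul_sub]
      abel

@[simp] theorem counitU_insLin (n : N2) (u : P.U) : ∀ v : P.V n,
    P.counitU (P.insLin n u v) = 0 := by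
  induction u using P.U_induction with
  | add u w hu hw => intro v; simp only [map_add, LinearMap.add_apply, hu, hw, add_zero]
  | smul c u hu => intro v; simp only [map_smul, LinearMap.smul_apply, hu, smul_zero]
  | one => intro v; rw [insLin_one, counitU_toU]
  | mul x u hu => intro v; rw [insLin_ι_mul, map_sub, map_mul, hu, hu, mul_zero, sub_zero]

theorem noncommProd_pow_erase {ι M : Type*} [DecidableEq ι] [Monoid M] (A : ι → M)
    (hA : ∀ i j, Commute (A i) (A j)) (k : ι →₀ ℕ) (i : ι) :
    k.support.noncommProd (fun j => A j ^ k j) (fun _ _ _ _ _ => (hA _ _).pow_pow _ _)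
      = A i ^ k i * (k.erase i).support.noncommProd (fun j => A j ^ (k.erase i) j)
          (fun _ _ _ _ _ => (hA _ _).pow_pow _ _) := by
  have h : (k.erase i).support.noncommProd (fun j => A j ^ (k.erase i) j)
          (fun _ _ _ _ _ => (hA _ _).pow_pow _ _)
      = (k.support.erase i).noncommProd (fun j => A j ^ k j)
          (fun _ _ _ _ _ => (hA _ _).pow_pow _ _) :=
    Finset.noncommProd_congr (Finsupp.support_erase) (fun j hj => by
      rw [Finsupp.erase_ne (Finset.ne_of_mem_erase hj)]) _
  rw [h]
  by_cases hi : i ∈ k.support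
  · exact (Finset.mul_noncommProd_erase k.support hi (fun j => A j ^ k j) _).symm
  · rw [Finsupp.notMem_support_iff.1 hi, pow_zero, one_mul]
    exact Finset.noncommProd_congr (Finset.erase_eq_of_notMem hi).symm (fun _ _ => rfl) _

theorem noncommProd_pow_add_single {ι M : Type*} [Monoid M] (A : ι → M)
    (hA : ∀ i j, Commute (A i) (A j)) (k : ι →₀ ℕ) (i : ι) :
    (k + Finsupp.single i 1).support.noncommProd (fun j => A j ^ (k + Finsupp.single i 1 : ι →₀ ℕ) j)
        (fun _ _ _ _ _ => (hA _ _).pow_pow _ _)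
      = A i * k.support.noncommProd (fun j => A j ^ k j) (fun _ _ _ _ _ => (hA _ _).pow_pow _ _) := by
  classical
  rw [noncommProd_pow_erase A hA k i, noncommProd_pow_erase A hA _ i, ← mul_assoc, ← pow_succ']
  have h : (k + Finsupp.single i 1).erase i = k.erase i := by
    ext j
    by_cases hj : j = i
    · subst hj; simp
    · simp [Finsupp.erase_ne hj]
  rw [h, Finsupp.add_apply, Finsupp.single_eq_same]

theorem prod_factorial_add_single {ι : Type*} (k : ι →₀ ℕ) (i : ι) :
    ((k + Finsupp.single i 1).prod fun _ m => (m.factorial : ℝ))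
      = ((k i : ℝ) + 1) * k.prod fun _ m => (m.factorial : ℝ) := by
  classical
  have h1 := fun k : ι →₀ ℕ =>
    Finsupp.mul_prod_erase' k i (fun _ m => (m.factorial : ℝ)) (fun _ => by simp)
  rw [← h1 k, ← h1 (k + Finsupp.single i 1)]
  have h : (k + Finsupp.single i 1).erase i = k.erase i := by
    ext j
    by_cases hj : j = i
    · subst hj; simp
    · simp [Finsupp.erase_ne hj]
  rw [h, Finsupp.add_apply, Finsupp.single_eq_same, Nat.factorial_succ]
  push_cast
  ring

theorem smul_prod_factorial_inv {ι : Type*} (k : ι →₀ ℕ) (i : ι) :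
    ((k i : ℝ) + 1) * ((k + Finsupp.single i 1).prod fun _ m => (m.factorial : ℝ))⁻¹
      = (k.prod fun _ m => (m.factorial : ℝ))⁻¹ := by
  rw [prod_factorial_add_single, mul_inv, ← mul_assoc, mul_inv_cancel₀ (by positivity), one_mul]

theorem comapDomain_add_single_inl {α β : Type*} (K : α ⊕ β →₀ ℕ) (a : α) :
    (K + Finsupp.single (Sum.inl a) 1).comapDomain Sum.inl Sum.inl_injective.injOn
      = K.comapDomain Sum.inl Sum.inl_injective.injOn + Finsupp.single a 1 := by
  classical
  ext b
  simp [Finsupp.single_apply]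

theorem shiftU_commute (i j : Fin 2) : Commute (P.shiftU i) (P.shiftU j) := by
  rw [commute_iff_lie_eq, shiftU, shiftU, ← LieHom.map_lie]
  convert map_zero P.toU
  exact Subtype.ext (lie_shift_shift i j)

theorem DJM_add_inl (K : P.JM) (p : P.Pair) :
    ((K (Sum.inl p) : ℝ) + 1) • P.DJM (K + Finsupp.single (Sum.inl p) 1) = P.ins p (P.DJM K) := by
  have h := noncommProd_pow_add_single P.ins P.ins_commute
    (K.comapDomain Sum.inl Sum.inl_injective.injOn) p
  simp only [← comapDomain_add_single_inl, Finsupp.comapDomain_apply] at h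
  rw [DJM, smul_smul, smul_prod_factorial_inv, h, DJM, map_smul]
  simp

theorem DJM_of_inl_eq_zero {K : P.JM} (hK : ∀ p, K (Sum.inl p) = 0) :
    P.DJM K = (K.prod fun _ k => (k.factorial : ℝ))⁻¹ •
      (P.shiftU 0 ^ K (Sum.inr 0) * P.shiftU 1 ^ K (Sum.inr 1)) := by
  have h : ∀ k : P.Pair →₀ ℕ, k = 0 → k.support.noncommProd (fun p => P.ins p ^ k p)
      (fun p _ q _ _ => (P.ins_commute p q).pow_pow _ _) = 1 := by
    rintro k rfl
    rfl
  have := h (K.comapDomain Sum.inl Sum.inl_injective.injOn) (by ext; simp [hK])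
  simp only [Finsupp.comapDomain_apply] at this
  rw [DJM, this]
  simp

theorem DJM_zero : P.DJM 0 = 1 := by
  rw [P.DJM_of_inl_eq_zero fun _ => rfl]
  simp

theorem DJM_add_inr {K : P.JM} (hK : ∀ p, K (Sum.inl p) = 0) (i : Fin 2) :
    ((K (Sum.inr i) : ℝ) + 1) • P.DJM (K + Finsupp.single (Sum.inr i) 1)
      = P.shiftU i * P.DJM K := by
  rw [P.DJM_of_inl_eq_zero hK, P.DJM_of_inl_eq_zero (by simp [hK]), smul_smul,
    smul_prod_factorial_inv, mul_smul_comm]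
  congr 1
  fin_cases i
  · simp [pow_succ', mul_assoc]
  · simp only [Fin.mk_one, Finsupp.add_apply, Finsupp.single_eq_same]
    rw [Finsupp.single_eq_of_ne (by simp), add_zero, pow_succ', ← mul_assoc, ← mul_assoc,
      ((P.shiftU_commute 0 1).pow_left _).eq]

theorem JM_induction {p : P.JM → Prop} (zero : p 0)
    (inr : ∀ K i, (∀ q, K (Sum.inl q) = 0) → p K → p (K + Finsupp.single (Sum.inr i) 1))
    (inl : ∀ K q, p K → p (K + Finsupp.single (Sum.inl q) 1)) (K : P.JM) : p K := by
  obtain ⟨d, hd⟩ : ∃ d, K.degree = d := ⟨_, rfl⟩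
  induction d generalizing K with
  | zero => rw [(Finsupp.degree_eq_zero_iff K).1 hd]; exact zero
  | succ d ih =>
    have split : ∀ i, K i ≠ 0 → ∃ K', K'.degree = d ∧ K = K' + Finsupp.single i 1 := fun i hi => by
      have hK : K = K - Finsupp.single i 1 + Finsupp.single i 1 := by
        rw [tsub_add_cancel_of_le]
        simpa [Nat.one_le_iff_ne_zero] using hi
      refine ⟨_, ?_, hK⟩
      rw [hK, map_add, Finsupp.degree_single] at hd
      exact Nat.succ_injective hd
    by_cases h : ∃ q, K (Sum.inl q) ≠ 0
    · obtain ⟨q, hq⟩ := h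
      obtain ⟨K', h1, rfl⟩ := split _ hq
      exact inl _ _ (ih _ h1)
    · push Not at h
      obtain ⟨i, hi⟩ : ∃ i, K i ≠ 0 := by
        by_contra! h0
        have : K = 0 := Finsupp.ext h0
        simp [this] at hd
      rcases i with q | i
      · exact absurd (h q) hi
      obtain ⟨K', h1, rfl⟩ := split _ hi
      exact inr _ _ (fun q => by simpa using h q) (ih _ h1)

theorem sum_antidiagonal_add_single {ι M : Type*} [DecidableEq ι] [AddCommGroup M] [Module ℝ M]
    (K : ι →₀ ℕ) (i : ι) (f : (ι →₀ ℕ) × (ι →₀ ℕ) → M) :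
    ∑ x ∈ Finset.HasAntidiagonal.antidiagonal (K + Finsupp.single i 1 : ι →₀ ℕ), (x.1 i : ℝ) • f x
      = ∑ x ∈ Finset.HasAntidiagonal.antidiagonal K,
          ((x.1 i : ℝ) + 1) • f (x.1 + Finsupp.single i 1, x.2) := by
  symm
  refine Finset.sum_of_injOn (fun x => (x.1 + Finsupp.single i 1, x.2)) ?_ ?_ ?_ ?_
  · rintro ⟨a, b⟩ - ⟨a', b'⟩ - h
    simpa using h
  · rintro ⟨a, b⟩ h
    simp only [Finset.mem_coe, Finset.HasAntidiagonal.mem_antidiagonal] at h ⊢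
    rw [← h, add_right_comm]
  · rintro ⟨a, b⟩ h h'
    by_cases ha : a i = 0
    · simp [ha]
    · exfalso
      apply h'
      have hle : Finsupp.single i 1 ≤ a := by simpa [Nat.one_le_iff_ne_zero] using ha
      refine ⟨(a - Finsupp.single i 1, b), ?_, by simp [tsub_add_cancel_of_le hle]⟩
      simp only [Finset.mem_coe, Finset.HasAntidiagonal.mem_antidiagonal] at h ⊢
      refine add_right_cancel (b := Finsupp.single i 1) ?_
      rw [← h, add_right_comm, tsub_add_cancel_of_le hle]
  · rintro ⟨a, b⟩ -
    simp

theorem comulU_DJM_step [DecidableEq P.LIdx] {K : P.JM} {i : P.LIdx} {A : Module.End ℝ P.U}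
    (hA : ∀ u, P.comulU (A u) = P.bothSides A (P.comulU u))
    (hD : ∀ K' ≤ K, ((K' i : ℝ) + 1) • P.DJM (K' + Finsupp.single i 1) = A (P.DJM K'))
    (hK : P.comulU (P.DJM K) = ∑ x ∈ Finset.HasAntidiagonal.antidiagonal K, P.DJM x.1 ⊗ₜ[ℝ] P.DJM x.2) :
    P.comulU (P.DJM (K + Finsupp.single i 1))
      = ∑ x ∈ Finset.HasAntidiagonal.antidiagonal (K + Finsupp.single i 1), P.DJM x.1 ⊗ₜ[ℝ] P.DJM x.2 := by
  have h0 : ((K i : ℝ) + 1) ≠ 0 := by positivity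
  refine smul_right_injective _ h0 ?_
  simp only
  rw [← map_smul, hD K le_rfl, hA, hK, map_sum, Finset.smul_sum]
  have h1 : ∀ x ∈ Finset.HasAntidiagonal.antidiagonal (K + Finsupp.single i 1),
      ((K i : ℝ) + 1) • (P.DJM x.1 ⊗ₜ[ℝ] P.DJM x.2) = (x.1 i : ℝ) • (P.DJM x.1 ⊗ₜ[ℝ] P.DJM x.2)
        + (x.2 i : ℝ) • (P.DJM x.1 ⊗ₜ[ℝ] P.DJM x.2) := fun x hx => by
    have := DFunLike.congr_fun (Finset.HasAntidiagonal.mem_antidiagonal.1 hx) i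
    simp only [Finsupp.add_apply, Finsupp.single_eq_same] at this
    rw [← add_smul, ← Nat.cast_add, this]
    push_cast
    rfl
  rw [Finset.sum_congr rfl h1, Finset.sum_add_distrib, sum_antidiagonal_add_single,
    Finsupp.sum_antidiagonal_swap (K + Finsupp.single i 1)
      (fun a b => (b i : ℝ) • (P.DJM a ⊗ₜ[ℝ] P.DJM b)),
    sum_antidiagonal_add_single K i (fun x => P.DJM x.2 ⊗ₜ[ℝ] P.DJM x.1),
    Finsupp.sum_antidiagonal_swap K
      (fun a b => ((a i : ℝ) + 1) • (P.DJM b ⊗ₜ[ℝ] P.DJM (a + Finsupp.single i 1))),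
    ← Finset.sum_add_distrib]
  refine Finset.sum_congr rfl fun x hx => ?_
  have hx' := Finset.HasAntidiagonal.mem_antidiagonal.1 hx
  rw [bothSides_tmul, ← hD x.1 (hx' ▸ le_self_add), ← hD x.2 (hx' ▸ le_add_self),
    TensorProduct.smul_tmul', TensorProduct.tmul_smul]

theorem comulU_DJM [DecidableEq P.LIdx] (K : P.JM) :
    P.comulU (P.DJM K) = ∑ x ∈ Finset.HasAntidiagonal.antidiagonal K, P.DJM x.1 ⊗ₜ[ℝ] P.DJM x.2 := by
  induction K using P.JM_induction with
  | zero => simp [DJM_zero, Algebra.TensorProduct.one_def]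
  | inr K i hK h =>
    refine P.comulU_DJM_step (A := LinearMap.mulLeft ℝ (P.shiftU i)) (fun u => ?_)
      (fun K' h' => P.DJM_add_inr (fun q => ?_) i) h
    · exact P.comulU_toU_mul _ u
    · have := h' (Sum.inl q)
      rw [hK] at this
      exact Nat.le_zero.1 this
  | inl K q h =>
    exact P.comulU_DJM_step (fun u => P.comulU_insLin _ u _) (fun K' _ => P.DJM_add_inl K' q) h

theorem counitU_DJM [DecidableEq P.LIdx] (K : P.JM) :
    P.counitU (P.DJM K) = if K = 0 then 1 else 0 := by
  have h0 : ∀ K : P.JM, ∀ i, K + Finsupp.single i 1 ≠ 0 := fun K i h => by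
    have := DFunLike.congr_fun h i
    simp at this
  induction K using P.JM_induction with
  | zero => simp [DJM_zero]
  | inr K i hK h =>
    rw [if_neg (h0 _ _)]
    have h1 := congrArg P.counitU (P.DJM_add_inr hK i)
    rw [map_smul, map_mul, shiftU, counitU_toU, zero_mul, smul_eq_mul] at h1
    exact (mul_eq_zero.1 h1).resolve_left (by positivity)
  | inl K q h =>
    rw [if_neg (h0 _ _)]
    have h1 := congrArg P.counitU (P.DJM_add_inl K q)
    rw [map_smul, ins, LinearMap.flip_apply, counitU_insLin, smul_eq_mul] at h1
    exact (mul_eq_zero.1 h1).resolve_left (by positivity)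

theorem insLin_mem_span (n : N2) (v : P.V n) {u : P.U}
    (hu : u ∈ Submodule.span ℝ (Set.range P.DJM)) :
    P.insLin n u v ∈ Submodule.span ℝ (Set.range P.DJM) := by
  obtain ⟨v, hv⟩ := v
  change v ∈ P.VSpan n at hv
  suffices h : ∀ u ∈ Submodule.span ℝ (Set.range P.DJM), ∀ γ (h : P.Adm γ n),
      P.ins ⟨(γ, n), h⟩ u ∈ Submodule.span ℝ (Set.range P.DJM) by
    induction hv using Submodule.span_induction with
    | mem f hf =>
      obtain ⟨γ, hγ, rfl⟩ := hf
      exact h u hu γ hγ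
    | zero => exact (map_zero (P.insLin n u)) ▸ zero_mem _
    | add f g hf hg h1 h2 =>
      exact (map_add (P.insLin n u) ⟨f, hf⟩ ⟨g, hg⟩) ▸ add_mem h1 h2
    | smul c f hf h1 =>
      exact (map_smul (P.insLin n u) c ⟨f, hf⟩) ▸ Submodule.smul_mem _ c h1
  intro u hu γ h
  induction hu using Submodule.span_induction with
  | mem u hu =>
    obtain ⟨K, rfl⟩ := hu
    rw [← DJM_add_inl]
    exact Submodule.smul_mem _ _ (Submodule.subset_span ⟨_, rfl⟩)
  | zero => rw [map_zero]; exact zero_mem _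
  | add u w _ _ hu hw => rw [map_add]; exact add_mem hu hw
  | smul c u _ hu => rw [map_smul]; exact Submodule.smul_mem _ _ hu

theorem shiftU_mul_mem_span (i : Fin 2) {u : P.U} (hu : u ∈ Submodule.span ℝ (Set.range P.DJM)) :
    P.shiftU i * u ∈ Submodule.span ℝ (Set.range P.DJM) := by
  induction hu using Submodule.span_induction with
  | mem u hu =>
    obtain ⟨K, rfl⟩ := hu
    have h0 : ∀ K : P.JM, (∀ q, K (Sum.inl q) = 0) →
        P.shiftU i * P.DJM K ∈ Submodule.span ℝ (Set.range P.DJM) := fun K hK => by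
      rw [← P.DJM_add_inr hK]
      exact Submodule.smul_mem _ _ (Submodule.subset_span ⟨_, rfl⟩)
    induction K using P.JM_induction with
    | zero => exact h0 0 fun _ => rfl
    | inr K j hK _ => exact h0 _ (by simp [hK])
    | inl K q h =>
      have hne : (K (Sum.inl q) : ℝ) + 1 ≠ 0 := by positivity
      rw [← Submodule.smul_mem_iff _ hne, ← mul_smul_comm, DJM_add_inl, ins, LinearMap.flip_apply]
      have := P.insLin_ι_mul q.1.2 ⟨shift i, Submodule.subset_span (Or.inl ⟨i, rfl⟩)⟩ (P.DJM K)
        ⟨mon q.1.1, P.mon_mem_VSpan q.2⟩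
      rw [eq_sub_iff_add_eq] at this
      rw [shiftU, ← this]
      exact add_mem (P.insLin_mem_span _ _ h)
        (P.insLin_mem_span _ _ (Submodule.subset_span ⟨_, rfl⟩))
  | zero => rw [mul_zero]; exact zero_mem _
  | add u w _ _ hu hw => rw [mul_add]; exact add_mem hu hw
  | smul c u _ hu => rw [mul_smul_comm]; exact Submodule.smul_mem _ _ hu

/-- Linear statements on `L` may be checked on the generators. -/
theorem L_induction {p : P.L → Prop} (zero : p 0) (add : ∀ x y, p x → p y → p (x + y))
    (smul : ∀ (c : ℝ) x, p x → p (c • x))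
    (shift : ∀ i, p ⟨shift i, Submodule.subset_span (Or.inl ⟨i, rfl⟩)⟩)
    (tilt : ∀ n (v : P.V n), p (P.tiltL n v)) (x : P.L) : p x := by
  obtain ⟨D, hD⟩ := x
  change D ∈ P.LSpan at hD
  induction hD using Submodule.span_induction with
  | mem D hD =>
    rcases hD with ⟨i, rfl⟩ | ⟨γ, n, h, rfl⟩
    · exact shift i
    · exact tilt n ⟨mon γ, P.mon_mem_VSpan h⟩
  | zero => exact zero
  | add x y hx hy h1 h2 => exact add ⟨x, hx⟩ ⟨y, hy⟩ h1 h2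
  | smul c x hx h1 => exact smul c ⟨x, hx⟩ h1

theorem toU_mem_span (x : P.L) : P.toU x ∈ Submodule.span ℝ (Set.range P.DJM) := by
  have h1 : (1 : P.U) ∈ Submodule.span ℝ (Set.range P.DJM) :=
    Submodule.subset_span ⟨0, P.DJM_zero⟩
  induction x using P.L_induction with
  | zero => rw [map_zero]; exact zero_mem _
  | add x y hx hy => rw [map_add]; exact add_mem hx hy
  | smul c x hx => rw [map_smul]; exact Submodule.smul_mem _ _ hx
  | shift i =>
    have := P.shiftU_mul_mem_span i h1
    rwa [mul_one] at this
  | tilt n v =>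
    have := P.insLin_mem_span n v h1
    rwa [insLin_one] at this

theorem toU_mul_DJM_mem_span (K : P.JM) : ∀ x : P.L,
    P.toU x * P.DJM K ∈ Submodule.span ℝ (Set.range P.DJM) := by
  induction K using P.JM_induction with
  | zero => intro x; rw [DJM_zero, mul_one]; exact P.toU_mem_span x
  | inr K i hK h =>
    intro x
    have hne : (K (Sum.inr i) : ℝ) + 1 ≠ 0 := by positivity
    rw [← Submodule.smul_mem_iff _ hne, ← mul_smul_comm, P.DJM_add_inr hK]
    set y : P.L := ⟨shift i, Submodule.subset_span (Or.inl ⟨i, rfl⟩)⟩ with hy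
    have h2 : P.toU x * (P.shiftU i * P.DJM K)
        = P.toU ⁅x, y⁆ * P.DJM K + P.shiftU i * (P.toU x * P.DJM K) := by
      rw [LieHom.map_lie, LieRing.of_associative_ring_bracket, sub_mul, mul_assoc, mul_assoc, shiftU]
      abel
    rw [h2]
    exact add_mem (h _) (P.shiftU_mul_mem_span i (h x))
  | inl K q h =>
    intro x
    have hne : (K (Sum.inl q) : ℝ) + 1 ≠ 0 := by positivity
    rw [← Submodule.smul_mem_iff _ hne, ← mul_smul_comm, DJM_add_inl, ins, LinearMap.flip_apply]
    have := P.insLin_ι_mul q.1.2 x (P.DJM K) ⟨mon q.1.1, P.mon_mem_VSpan q.2⟩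
    rw [eq_sub_iff_add_eq] at this
    rw [← this]
    exact add_mem (P.insLin_mem_span _ _ (h x))
      (P.insLin_mem_span _ _ (Submodule.subset_span ⟨_, rfl⟩))

theorem span_DJM : Submodule.span ℝ (Set.range P.DJM) = ⊤ := by
  suffices h : ∀ u, u ∈ Submodule.span ℝ (Set.range P.DJM) from eq_top_iff.2 fun u _ => h u
  intro u
  induction u using P.U_induction with
  | add u w hu hw => exact add_mem hu hw
  | smul c u hu => exact Submodule.smul_mem _ _ hu
  | one => exact Submodule.subset_span ⟨0, P.DJM_zero⟩
  | mul x u hu =>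
    induction hu using Submodule.span_induction with
    | mem u hu =>
      obtain ⟨K, rfl⟩ := hu
      exact P.toU_mul_DJM_mem_span K x
    | zero => rw [mul_zero]; exact zero_mem _
    | add u w _ _ hu hw =>
      rw [mul_add]
      exact add_mem hu hw
    | smul c u _ hu => rw [mul_smul_comm]; exact Submodule.smul_mem _ _ hu

/-- The value `D z_n` of a derivation `D`; for `n = 0` this is `(D z_0) / z_1`, the value on an
additional variable `z_n` with `n = 0`. -/
def varValue (n : N2) : Derivation ℝ PS PS →ₗ[ℝ] PS :=
  if h : n = 0 then
    { toFun := fun D β => coeff (β + Finsupp.single (Sum.inl 1) 1) (D (X (Sum.inl 0)))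
      map_add' := fun _ _ => rfl
      map_smul' := fun _ _ => rfl }
  else
    { toFun := fun D => D (X (Sum.inr ⟨n, h⟩))
      map_add' := fun _ _ => rfl
      map_smul' := fun _ _ => rfl }

theorem varValue_of_ne {n : N2} (h : n ≠ 0) (D : Derivation ℝ PS PS) :
    varValue n D = D (X (Sum.inr ⟨n, h⟩)) := by
  rw [varValue, dif_neg h]
  rfl

theorem varValue_zero_of_eq {D : Derivation ℝ PS PS} {f : PS}
    (h : D (X (Sum.inl 0)) = f * X (Sum.inl 1)) : varValue 0 D = f := by
  rw [varValue, dif_pos rfl]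
  ext β
  change coeff (β + Finsupp.single (Sum.inl 1) 1) (D (X (Sum.inl 0))) = _
  rw [h, X, coeff_add_mul_monomial, mul_one]

theorem varValue_shift (n : N2) (i : Fin 2) :
    varValue n (shift i) = ((n i : ℝ) + 1) • X (varAdd n i) := by
  by_cases h : n = 0
  · subst h
    apply varValue_zero_of_eq
    rw [shift_inl]
    simp
  · rw [varValue_of_ne h, shift_inr]

theorem varValue_smul_tilt (n m : N2) (f : PS) :
    varValue n (f • tilt m) = if n = m then f else 0 := by
  by_cases h : n = 0
  · subst h
    apply varValue_zero_of_eq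
    rw [Derivation.smul_apply]
    by_cases hm : m = 0
    · subst hm
      rw [tilt_zero_inl]
      simp
    · rw [tilt_inl hm, if_neg (Ne.symm hm)]
      simp
  · rw [varValue_of_ne h, Derivation.smul_apply, tilt_inr]
    split_ifs <;> simp

theorem apply_inl_eq (x : P.L) (k : ℕ) :
    x.1 (X (Sum.inl k)) = ((k : ℝ) + 1) • (varValue 0 x.1 * X (Sum.inl (k + 1))) := by
  induction x using P.L_induction with
  | zero =>
    change (0 : PS) = _
    simp
  | add x y hx hy =>
    change x.1 _ + y.1 _ = ((k : ℝ) + 1) • (varValue 0 (x.1 + y.1) * _)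
    rw [map_add, add_mul, smul_add, hx, hy]
  | smul c x hx =>
    change c • x.1 _ = ((k : ℝ) + 1) • (varValue 0 (c • x.1) * _)
    rw [map_smul, smul_mul_assoc, smul_comm, hx]
  | shift i =>
    simp only [varValue_shift, shift_inl]
    simp
  | tilt n v =>
    change v.1 • tilt n _ = ((k : ℝ) + 1) • (varValue 0 (v.1 • tilt n) * _)
    rw [varValue_smul_tilt]
    by_cases hn : 0 = n
    · subst hn
      rw [tilt_zero_inl, if_pos rfl, smul_eq_mul, mul_smul_comm]
    · rw [tilt_inl (Ne.symm hn), if_neg hn]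
      simp

theorem varValue_lie (n : N2) (x y : P.L) :
    varValue n ⁅x.1, y.1⁆ = x.1 (varValue n y.1) - y.1 (varValue n x.1) := by
  by_cases h : n = 0
  · subst h
    apply varValue_zero_of_eq
    rw [Derivation.commutator_apply, apply_inl_eq, apply_inl_eq]
    simp only [Derivation.map_smul, Derivation.leibniz, apply_inl_eq, smul_eq_mul]
    simp only [Algebra.smul_def, Nat.cast_zero, zero_add, map_one, Nat.cast_one, one_mul, map_add]
    ring
  · simp only [varValue_of_ne h, Derivation.commutator_apply]

theorem mon_mem_Tstar {γ : MI} (h : InT γ) : mon γ ∈ P.Tstar := fun δ hδ => by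
  rwa [eq_of_coeff_monomial_ne_zero hδ]

theorem VSpan_le_Tstar (n : N2) : P.VSpan n ≤ P.Tstar.toSubmodule := by
  refine Submodule.span_le.2 ?_
  rintro _ ⟨γ, h, rfl⟩
  exact P.mon_mem_Tstar (Or.inl h.1)

theorem varValue_mem_Tstar (n : N2) (x : P.L) : varValue n x.1 ∈ P.Tstar := by
  induction x using P.L_induction with
  | zero =>
    have : varValue n (0 : P.L).1 = 0 := map_zero (varValue n)
    rw [this]
    exact zero_mem _
  | add x y hx hy =>
    have : varValue n (x + y).1 = varValue n x.1 + varValue n y.1 := map_add (varValue n) x.1 y.1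
    rw [this]
    exact add_mem hx hy
  | smul c x hx =>
    have : varValue n (c • x).1 = c • varValue n x.1 := map_smul (varValue n) c x.1
    rw [this]
    exact P.Tstar.smul_mem c hx
  | shift i =>
    rw [varValue_shift]
    exact P.Tstar.smul_mem _ (P.mon_mem_Tstar (Or.inr ⟨_, rfl⟩))
  | tilt m v =>
    have h := varValue_smul_tilt n m v.1
    change varValue n (v.1 • tilt m) ∈ _
    rw [h]
    split_ifs
    · exact P.VSpan_le_Tstar m v.2
    · exact zero_mem _

/-- The map `D ↦ D z_n` as a cocycle on `L` with values in `T*`. -/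
def cocycle (n : N2) : P.L →ₗ[ℝ] P.Tstar where
  toFun x := ⟨varValue n x.1, P.varValue_mem_Tstar n x⟩
  map_add' x y := Subtype.ext (map_add (varValue n) x.1 y.1)
  map_smul' c x := Subtype.ext (map_smul (varValue n) c x.1)

theorem cocycle_lie (n : N2) (x y : P.L) :
    P.cocycle n ⁅x, y⁆ = ⁅x, P.cocycle n y⁆ - ⁅y, P.cocycle n x⁆ :=
  Subtype.ext (P.varValue_lie n x y)

/-- The action of `L` on the extension of the trivial module `ℝ` by `T*` given by the cocycle. -/
def extAct (n : N2) : P.L →ₗ⁅ℝ⁆ Module.End ℝ (P.Tstar × ℝ) where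
  toFun x := LinearMap.inl ℝ P.Tstar ℝ ∘ₗ
    ((LieModule.toEnd ℝ P.L P.Tstar x).coprod (LinearMap.toSpanSingleton ℝ P.Tstar (P.cocycle n x)))
  map_add' x y := by
    ext <;> simp
  map_smul' c x := by
    ext <;> simp
  map_lie' {x y} := by
    ext <;> simp [LieRing.of_associative_ring_bracket, cocycle_lie]

theorem extAct_apply (n : N2) (x : P.L) (w : P.Tstar × ℝ) :
    P.extAct n x w = (⁅x, w.1⁆ + w.2 • P.cocycle n x, 0) := rfl

/-- The representation of `U(L)` that extends the action `extAct` of `L`. -/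
def extRep (n : N2) : P.U →ₐ[ℝ] Module.End ℝ (P.Tstar × ℝ) :=
  UniversalEnvelopingAlgebra.lift ℝ (P.extAct n)

theorem extRep_toU_mul (n : N2) (x : P.L) (u : P.U) (w : P.Tstar × ℝ) :
    P.extRep n (P.toU x * u) w = P.extAct n x (P.extRep n u w) := by
  rw [map_mul (P.extRep n), Module.End.mul_apply, extRep, UniversalEnvelopingAlgebra.lift_ι_apply]

theorem extRep_snd (n : N2) (u : P.U) : (P.extRep n u (0, 1)).2 = P.counitU u := by
  induction u using P.U_induction with
  | add u w hu hw => rw [map_add, map_add, LinearMap.add_apply, Prod.snd_add, hu, hw]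
  | smul c u hu => rw [map_smul, map_smul, LinearMap.smul_apply, Prod.smul_snd, hu]
  | one => rw [map_one, map_one, Module.End.one_apply]
  | mul x u hu =>
    rw [extRep_toU_mul, map_mul P.counitU, counitU_toU, zero_mul, extAct_apply]

/-- The map `u ↦ u z_n - ε(u) z_n` from `U(L)` to `T*`. -/
def xi (n : N2) : P.U →ₗ[ℝ] P.Tstar where
  toFun u := (P.extRep n u (0, 1)).1
  map_add' u v := by rw [map_add]; rfl
  map_smul' c u := by rw [map_smul]; rfl

theorem xi_one (n : N2) : P.xi n 1 = 0 := by simp [xi]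

theorem xi_toU_mul (n : N2) (x : P.L) (u : P.U) :
    P.xi n (P.toU x * u) = ⁅x, P.xi n u⁆ + P.counitU u • P.cocycle n x := by
  change (P.extRep n (P.toU x * u) (0, 1)).1 = _
  rw [extRep_toU_mul, extAct_apply, extRep_snd]
  rfl

theorem rho_toU_mul (x : P.L) (u : P.U) (f : P.Tstar) :
    P.rho (P.toU x * u) f = ⁅x, P.rho u f⁆ := by
  rw [map_mul, rho, UniversalEnvelopingAlgebra.lift_ι_apply]
  rfl

theorem xi_mul (n : N2) (u v : P.U) :
    P.xi n (u * v) = P.rho u (P.xi n v) + P.counitU v • P.xi n u := by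
  induction u using P.U_induction with
  | add u w hu hw => simp only [add_mul, map_add, hu, hw, LinearMap.add_apply, smul_add]; abel
  | smul c u hu =>
    simp only [smul_mul_assoc, map_smul, hu, LinearMap.smul_apply, smul_add]
    rw [smul_comm]
  | one => simp [xi_one]
  | mul x u hu =>
    rw [mul_assoc, xi_toU_mul, hu, rho_toU_mul, xi_toU_mul, lie_add, lie_smul, smul_add, smul_smul,
      add_assoc, map_mul, mul_comm]

theorem xi_insLin (n m : N2) (u : P.U) : ∀ v : P.V m,
    (P.xi n (P.insLin m u v) : PS) = if n = m then P.counitU u • v.1 else 0 := by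
  induction u using P.U_induction with
  | add u w hu hw =>
    intro v
    rw [map_add, LinearMap.add_apply, map_add, Submodule.coe_add, hu, hw, map_add, add_smul]
    split_ifs <;> simp
  | smul c u hu =>
    intro v
    rw [map_smul, LinearMap.smul_apply, map_smul, Submodule.coe_smul, hu, map_smul, smul_assoc]
    split_ifs <;> simp
  | one =>
    intro v
    rw [insLin_one, ← mul_one (UniversalEnvelopingAlgebra.ι ℝ _), xi_toU_mul, xi_one, map_one]
    simp only [lie_zero, zero_add, one_smul]
    exact varValue_smul_tilt n m v.1
  | mul x u hu =>
    intro v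
    rw [insLin_ι_mul, map_sub, xi_toU_mul, counitU_insLin, zero_smul, add_zero, map_mul,
      counitU_toU, zero_mul, zero_smul]
    have h1 : ((⁅x, P.xi n (P.insLin m u v)⁆ - P.xi n (P.insLin m u ⁅x, v⁆) : P.Tstar) : PS)
        = x.1 (P.xi n (P.insLin m u v)).1 - (P.xi n (P.insLin m u ⁅x, v⁆)).1 := rfl
    rw [h1, hu, hu]
    split_ifs
    · rw [Derivation.map_smul]
      exact sub_self _
    · simp

theorem xi_DJM_of_inl_eq_zero (n : N2) {K : P.JM} (hK : ∀ q, K (Sum.inl q) = 0) {β : MI}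
    (hβ : coeff β (P.xi n (P.DJM K) : PS) ≠ 0) :
    K ≠ 0 ∧ ∃ h, β = Finsupp.single (Sum.inr ⟨n + fun i => K (Sum.inr i), h⟩) 1 := by
  classical
  induction K using P.JM_induction generalizing β with
  | zero =>
    rw [DJM_zero, xi_one] at hβ
    exact absurd rfl hβ
  | inl K q _ =>
    have := hK q
    simp at this
  | inr K i hK' ih =>
    have h1 := congrArg (fun u => coeff β (P.xi n u : PS)) (P.DJM_add_inr hK' i)
    simp only [map_smul, shiftU] at h1
    rw [xi_toU_mul, counitU_DJM] at h1
    have h2 : coeff β ((⁅(⟨shift i, Submodule.subset_span (Or.inl ⟨i, rfl⟩)⟩ : P.L),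
        P.xi n (P.DJM K)⁆ + (if K = 0 then (1 : ℝ) else 0) • P.cocycle n
          ⟨shift i, Submodule.subset_span (Or.inl ⟨i, rfl⟩)⟩ : P.Tstar) : PS) ≠ 0 := by
      rw [← h1]
      exact mul_ne_zero (show (K (Sum.inr i) : ℝ) + 1 ≠ 0 by positivity) hβ
    have h3 : ((⁅(⟨shift i, Submodule.subset_span (Or.inl ⟨i, rfl⟩)⟩ : P.L),
        P.xi n (P.DJM K)⁆ + (if K = 0 then (1 : ℝ) else 0) • P.cocycle n
          ⟨shift i, Submodule.subset_span (Or.inl ⟨i, rfl⟩)⟩ : P.Tstar) : PS)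
        = shift i (P.xi n (P.DJM K) : PS) + (if K = 0 then (1 : ℝ) else 0) • varValue n (shift i) :=
      rfl
    rw [h3, varValue_shift, map_add] at h2
    have hm : (fun j => (K + Finsupp.single (Sum.inr i) 1 : P.JM) (Sum.inr j))
        = (fun j => K (Sum.inr j)) + unit i := by
      funext j
      by_cases hj : j = i
      · subst hj; simp [unit]
      · simp [unit, hj]
    refine ⟨fun h => ?_, ?_⟩
    · have := DFunLike.congr_fun h (Sum.inr i)
      simp at this
    · simp only [hm, ← add_assoc]
      refine ⟨add_unit_ne_zero _ _, ?_⟩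
      by_cases h0 : K = 0
      · subst h0
        rw [DJM_zero, xi_one, if_pos rfl, one_smul] at h2
        simp only [ZeroMemClass.coe_zero, map_zero, zero_add, coeff_smul] at h2
        have := eq_of_coeff_monomial_ne_zero (right_ne_zero_of_mul h2)
        rw [this, varAdd]
        simp only [Finsupp.coe_zero, Pi.zero_apply]
        congr
      · rw [if_neg h0, zero_smul, map_zero, add_zero] at h2
        obtain ⟨γ, hγ, v, hv, -, hs⟩ := exists_step (shift_locFin i) h2
        obtain ⟨-, hne, rfl⟩ := ih hK' hγ
        rw [Finsupp.single_apply] at hv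
        have hv : Sum.inr ⟨n + fun i => K (Sum.inr i), hne⟩ = v := by by_contra h; exact hv (if_neg h)
        subst hv
        rw [add_comm] at hs
        exact add_left_cancel hs

theorem xi_DJM_add_inl (n : N2) (K : P.JM) (q : P.Pair) :
    ((K (Sum.inl q) : ℝ) + 1) • (P.xi n (P.DJM (K + Finsupp.single (Sum.inl q) 1)) : PS)
      = if n = q.1.2 then P.counitU (P.DJM K) • mon q.1.1 else 0 := by
  rw [← P.xi_insLin n q.1.2 (P.DJM K) ⟨mon q.1.1, P.mon_mem_VSpan q.2⟩]
  have h := congrArg (fun u => (P.xi n u : PS)) (P.DJM_add_inl K q)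
  simp only [map_smul] at h
  exact h

theorem xi_DJM (n : N2) {K : P.JM} {β : MI} (hβ : coeff β (P.xi n (P.DJM K) : PS) ≠ 0) :
    (∃ h : P.Adm β n, K = Finsupp.single (Sum.inl ⟨(β, n), h⟩) 1) ∨
      ((∀ q, K (Sum.inl q) = 0) ∧ K ≠ 0 ∧
        ∃ h, β = Finsupp.single (Sum.inr ⟨n + fun i => K (Sum.inr i), h⟩) 1) := by
  classical
  by_cases hK : ∀ q, K (Sum.inl q) = 0
  · exact Or.inr ⟨hK, P.xi_DJM_of_inl_eq_zero n hK hβ⟩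
  · left
    push Not at hK
    obtain ⟨q, hq⟩ := hK
    obtain ⟨K, rfl⟩ : ∃ K', K = K' + Finsupp.single (Sum.inl q) 1 :=
      ⟨K - Finsupp.single (Sum.inl q) 1, by
        rw [tsub_add_cancel_of_le]
        simpa [Nat.one_le_iff_ne_zero] using hq⟩
    have h1 := congrArg (coeff β) (P.xi_DJM_add_inl n K q)
    have h2 : ((K (Sum.inl q) : ℝ) + 1) * coeff β
        (P.xi n (P.DJM (K + Finsupp.single (Sum.inl q) 1)) : PS) ≠ 0 :=
      mul_ne_zero (by positivity) hβ
    rw [coeff_smul] at h1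
    rw [h1, counitU_DJM] at h2
    by_cases hn : n = q.1.2
    · by_cases h0 : K = 0
      · rw [if_pos hn, if_pos h0, one_smul] at h2
        have := eq_of_coeff_monomial_ne_zero h2
        subst this hn h0
        exact ⟨q.2, by rw [zero_add]⟩
      · rw [if_pos hn, if_neg h0, zero_smul, map_zero] at h2
        exact absurd rfl h2
    · rw [if_neg hn, map_zero] at h2
      exact absurd rfl h2

/-- The functional `u ↦ (u z_n)_β` on `U(L)`. -/
def coeffXi (n : N2) (β : MI) : P.U →ₗ[ℝ] ℝ :=
  coeff β ∘ₗ P.Tstar.toSubmodule.subtype ∘ₗ P.xi n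

theorem coeffXi_apply (n : N2) (β : MI) (u : P.U) : P.coeffXi n β u = coeff β (P.xi n u : PS) := rfl

/-- The multi-index `β` such that `coeffXi n β` is dual to a given basis element of `L`. -/
def genIdx : P.LIdx → MI
  | Sum.inl p => p.1.1
  | Sum.inr i => Finsupp.single (varAdd 0 i) 1

/-- The index `n` such that `coeffXi n β` is dual to a given basis element of `L`. -/
def genLen : P.LIdx → N2
  | Sum.inl p => p.1.2
  | Sum.inr _ => 0

theorem inT_genIdx (i : P.LIdx) : InT (P.genIdx i) := by
  rcases i with p | i
  · exact Or.inl p.2.1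
  · exact Or.inr ⟨_, rfl⟩

theorem coeffXi_gen_DJM [DecidableEq P.LIdx] (i : P.LIdx) (K : P.JM) :
    P.coeffXi (P.genLen i) (P.genIdx i) (P.DJM K) = if K = Finsupp.single i 1 then 1 else 0 := by
  rw [coeffXi_apply]
  split_ifs with h
  · subst h
    rcases i with p | i
    · have h1 := P.xi_DJM_add_inl p.1.2 0 p
      simp only [Finsupp.coe_zero, Pi.zero_apply, Nat.cast_zero, zero_add, one_smul, if_true,
        DJM_zero, map_one] at h1
      simp only [genLen, genIdx]
      rw [h1, mon, coeff_monomial_same]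
    · have h1 := P.DJM_add_inr (K := 0) (fun _ => rfl) i
      simp only [Finsupp.coe_zero, Pi.zero_apply, Nat.cast_zero, zero_add, one_smul,
        DJM_zero] at h1
      rw [h1, shiftU, xi_toU_mul, xi_one, map_one, lie_zero, zero_add, one_smul]
      change coeff _ (varValue 0 (shift i)) = 1
      rw [varValue_shift, genIdx, coeff_smul, X, coeff_monomial_same]
      simp
  · by_contra hne
    rcases i with p | i
    · rcases P.xi_DJM _ hne with ⟨_, hK⟩ | ⟨-, -, _, hβ⟩
      · exact h hK
      · have h1 := p.2.1
        have h2 := congrArg br hβ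
        simp only [genIdx, br_single_inr] at h2
        lia
    · rcases P.xi_DJM _ hne with ⟨hA, -⟩ | ⟨hK, -, _, hβ⟩
      · have h1 := hA.1
        simp [genIdx] at h1
      · apply h
        simp only [genIdx, genLen, varAdd] at hβ
        have h1 := Finsupp.single_left_injective (one_ne_zero) hβ
        simp only [Sum.inr.injEq, Subtype.mk.injEq, zero_add] at h1
        ext j
        rcases j with q | j
        · rw [hK, Finsupp.single_eq_of_ne (by simp)]
        · have h2 := congrFun h1 j
          rw [← h2]
          by_cases hj : j = i
          · subst hj; simp [unit]
          · simp [unit, hj]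

/-- The pairing of a tensor with two functionals. -/
def ev2 {A B : Type*} [AddCommGroup A] [Module ℝ A] [AddCommGroup B] [Module ℝ B]
    (f : A →ₗ[ℝ] ℝ) (g : B →ₗ[ℝ] ℝ) : A ⊗[ℝ] B →ₗ[ℝ] ℝ :=
  LinearMap.mul' ℝ ℝ ∘ₗ TensorProduct.map f g

@[simp] theorem ev2_tmul {A B : Type*} [AddCommGroup A] [Module ℝ A] [AddCommGroup B] [Module ℝ B]
    (f : A →ₗ[ℝ] ℝ) (g : B →ₗ[ℝ] ℝ) (a : A) (b : B) : ev2 f g (a ⊗ₜ b) = f a * g b := rfl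

/-- The convolution of functionals on `U(L)`. -/
def conv (f g : P.U →ₗ[ℝ] ℝ) : P.U →ₗ[ℝ] ℝ := ev2 f g ∘ₗ P.comulU.toLinearMap

theorem conv_DJM [DecidableEq P.LIdx] (f g : P.U →ₗ[ℝ] ℝ) (K : P.JM) :
    P.conv f g (P.DJM K) =
      ∑ x ∈ Finset.HasAntidiagonal.antidiagonal K, f (P.DJM x.1) * g (P.DJM x.2) := by
  rw [conv, LinearMap.comp_apply, AlgHom.toLinearMap_apply, comulU_DJM, map_sum]
  rfl

theorem conv_dual [DecidableEq P.LIdx] {A B : P.JM} {f g : P.U →ₗ[ℝ] ℝ}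
    (hf : ∀ K, f (P.DJM K) = if K = A then 1 else 0)
    (hg : ∀ K, g (P.DJM K) = if K = B then 1 else 0) (K : P.JM) :
    P.conv f g (P.DJM K) = if K = A + B then 1 else 0 := by
  rw [conv_DJM]
  simp only [hf, hg]
  split_ifs with h
  · rw [Finset.sum_eq_single (A, B)]
    · simp
    · rintro ⟨a, b⟩ - hne
      by_cases ha : a = A
      · rw [if_neg (fun hb : b = B => hne (by rw [ha, hb])), mul_zero]
      · rw [if_neg ha, zero_mul]
    · intro hn
      exact absurd (Finset.HasAntidiagonal.mem_antidiagonal.2 h.symm) hn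
  · refine Finset.sum_eq_zero fun x hx => ?_
    by_cases ha : x.1 = A
    · rw [if_neg (fun hb : x.2 = B => h ?_), mul_zero]
      rw [← Finset.HasAntidiagonal.mem_antidiagonal.1 hx, ha, hb]
    · rw [if_neg ha, zero_mul]

theorem exists_dual [DecidableEq P.LIdx] (A : P.JM) :
    ∃ f : P.U →ₗ[ℝ] ℝ, ∀ K, f (P.DJM K) = if K = A then 1 else 0 := by
  induction A using Finsupp.induction_linear with
  | zero => exact ⟨P.counitU.toLinearMap, P.counitU_DJM⟩
  | add A B hA hB =>
    obtain ⟨f, hf⟩ := hA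
    obtain ⟨g, hg⟩ := hB
    exact ⟨P.conv f g, P.conv_dual hf hg⟩
  | single i k =>
    induction k with
    | zero => rw [Finsupp.single_zero]; exact ⟨P.counitU.toLinearMap, P.counitU_DJM⟩
    | succ k ih =>
      obtain ⟨f, hf⟩ := ih
      rw [Finsupp.single_add]
      exact ⟨P.conv f _, P.conv_dual hf (P.coeffXi_gen_DJM i)⟩

theorem linearIndependent_DJM : LinearIndependent ℝ P.DJM := by
  classical
  rw [linearIndependent_iff]
  intro l hl
  ext A
  obtain ⟨f, hf⟩ := P.exists_dual A
  have h := congrArg f hl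
  rw [Finsupp.apply_linearCombination, map_zero, Finsupp.linearCombination_apply] at h
  simpa [hf, Finsupp.sum] using h

/-- The basis `D_(J,m)` of `U(L)`. -/
def basisU : Module.Basis P.JM ℝ P.U := Module.Basis.mk P.linearIndependent_DJM P.span_DJM.ge

@[simp] theorem basisU_apply (K : P.JM) : P.basisU K = P.DJM K := Module.Basis.mk_apply _ _ K

/-- The representation of `U(L)` on all power series. -/
def rhoPS : P.U →ₐ[ℝ] Module.End ℝ PS :=
  UniversalEnvelopingAlgebra.lift ℝ (LieModule.toEnd ℝ P.L PS)

theorem rhoPS_toU_mul (x : P.L) (u : P.U) (f : PS) :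
    P.rhoPS (P.toU x * u) f = x.1 (P.rhoPS u f) := by
  rw [map_mul P.rhoPS, Module.End.mul_apply, rhoPS, UniversalEnvelopingAlgebra.lift_ι_apply]
  rfl

theorem coe_rho (u : P.U) (f : P.Tstar) : (P.rho u f : PS) = P.rhoPS u f := by
  induction u using P.U_induction with
  | add u w hu hw =>
    rw [map_add, map_add, LinearMap.add_apply, LinearMap.add_apply, ← hu, ← hw]; rfl
  | smul c u hu => rw [map_smul, map_smul, LinearMap.smul_apply, LinearMap.smul_apply, ← hu]; rfl
  | one => rw [map_one, map_one, Module.End.one_apply, Module.End.one_apply]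
  | mul x u hu => rw [rho_toU_mul, rhoPS_toU_mul, ← hu]; rfl

theorem rhoPS_insLin (n : N2) (u : P.U) (f : PS) : ∀ v : P.V n,
    P.rhoPS (P.insLin n u v) f = v.1 * P.rhoPS u (tilt n f) := by
  induction u using P.U_induction with
  | add u w hu hw =>
    intro v
    rw [map_add, LinearMap.add_apply, map_add, LinearMap.add_apply, hu, hw, map_add,
      LinearMap.add_apply, mul_add]
  | smul c u hu =>
    intro v
    rw [map_smul, LinearMap.smul_apply, map_smul, LinearMap.smul_apply, hu, map_smul,
      LinearMap.smul_apply, mul_smul_comm]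
  | one =>
    intro v
    rw [insLin_one, ← mul_one (UniversalEnvelopingAlgebra.ι ℝ _), rhoPS_toU_mul, map_one]
    rfl
  | mul x u hu =>
    intro v
    have h : (⁅x, v⁆ : P.V n).1 = x.1 v.1 := rfl
    rw [insLin_ι_mul, map_sub, LinearMap.sub_apply, rhoPS_toU_mul, hu, hu, rhoPS_toU_mul, h,
      Derivation.leibniz]
    simp only [smul_eq_mul]
    ring

theorem rhoPS_DJM_add_inl (K : P.JM) (q : P.Pair) (f : PS) :
    ((K (Sum.inl q) : ℝ) + 1) • P.rhoPS (P.DJM (K + Finsupp.single (Sum.inl q) 1)) f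
      = mon q.1.1 * P.rhoPS (P.DJM K) (tilt q.1.2 f) := by
  rw [← LinearMap.smul_apply, ← map_smul, DJM_add_inl]
  exact P.rhoPS_insLin _ _ _ _

theorem rhoPS_DJM_add_inr {K : P.JM} (hK : ∀ q, K (Sum.inl q) = 0) (i : Fin 2) (f : PS) :
    ((K (Sum.inr i) : ℝ) + 1) • P.rhoPS (P.DJM (K + Finsupp.single (Sum.inr i) 1)) f
      = shift i (P.rhoPS (P.DJM K) f) := by
  rw [← LinearMap.smul_apply, ← map_smul, P.DJM_add_inr hK]
  exact P.rhoPS_toU_mul _ _ _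

/-- The functionals on power series that depend on finitely many coefficients only. -/
def finFunctionals : Submodule ℝ (PS →ₗ[ℝ] ℝ) :=
  Submodule.span ℝ (Set.range fun γ : MI => coeff (R := ℝ) γ)

theorem comp_mem_finFunctionals {A : PS →ₗ[ℝ] PS} (hA : ∀ β, coeff β ∘ₗ A ∈ finFunctionals)
    {φ : PS →ₗ[ℝ] ℝ} (hφ : φ ∈ finFunctionals) : φ ∘ₗ A ∈ finFunctionals := by
  induction hφ using Submodule.span_induction with
  | mem φ h =>
    obtain ⟨β, rfl⟩ := h
    exact hA β
  | zero => rw [LinearMap.zero_comp]; exact zero_mem _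
  | add φ ψ _ _ h1 h2 => rw [LinearMap.add_comp]; exact add_mem h1 h2
  | smul c φ _ h => rw [LinearMap.smul_comp]; exact Submodule.smul_mem _ _ h

theorem coeff_comp_mul_mem (f : PS) (β : MI) :
    coeff β ∘ₗ LinearMap.mulLeft ℝ f ∈ finFunctionals := by
  classical
  have : coeff β ∘ₗ LinearMap.mulLeft ℝ f
      = ∑ p ∈ Finset.HasAntidiagonal.antidiagonal β, coeff p.1 f • coeff (R := ℝ) p.2 := by
    ext g
    simp [coeff_mul]
  rw [this]
  exact sum_mem fun p _ => Submodule.smul_mem _ _ (Submodule.subset_span ⟨_, rfl⟩)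

theorem coeff_comp_pderiv_mem (i : Var) (β : MI) :
    coeff β ∘ₗ (pderiv ℝ i : Derivation ℝ PS PS).toLinearMap ∈ finFunctionals := by
  have : coeff β ∘ₗ (pderiv ℝ i : Derivation ℝ PS PS).toLinearMap
      = ((β i : ℝ) + 1) • coeff (R := ℝ) (β + Finsupp.single i 1) := by
    ext g
    simp [coeff_pderiv, mul_comm]
  rw [this]
  exact Submodule.smul_mem _ _ (Submodule.subset_span ⟨_, rfl⟩)

theorem coeff_comp_vectorField_mem {a : Var → PS} (ha : IsLocFin a) (β : MI) :
    coeff β ∘ₗ (vectorField a ha).toLinearMap ∈ finFunctionals := by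
  have : coeff β ∘ₗ (vectorField a ha).toLinearMap = ∑ i ∈ (ha β).toFinset,
      (coeff β ∘ₗ LinearMap.mulLeft ℝ (a i)) ∘ₗ (pderiv ℝ i : Derivation ℝ PS PS).toLinearMap := by
    ext g
    rw [LinearMap.comp_apply]
    simp only [LinearMap.sum_apply, LinearMap.comp_apply]
    exact coeff_vectorField ha β g
  rw [this]
  exact sum_mem fun i _ => comp_mem_finFunctionals (coeff_comp_pderiv_mem i) (coeff_comp_mul_mem _ _)

theorem coeff_comp_L_mem (x : P.L) (β : MI) : coeff β ∘ₗ x.1.toLinearMap ∈ finFunctionals := by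
  induction x using P.L_induction with
  | zero =>
    have : coeff β ∘ₗ (0 : P.L).1.toLinearMap = (0 : PS →ₗ[ℝ] ℝ) := LinearMap.comp_zero _
    rw [this]
    exact zero_mem _
  | add x y hx hy =>
    have : coeff β ∘ₗ (x + y).1.toLinearMap = coeff β ∘ₗ x.1.toLinearMap + coeff β ∘ₗ y.1.toLinearMap :=
      LinearMap.comp_add _ _ _
    rw [this]
    exact add_mem hx hy
  | smul c x hx =>
    have : coeff β ∘ₗ (c • x).1.toLinearMap = c • (coeff β ∘ₗ x.1.toLinearMap) :=
      LinearMap.comp_smul _ _ _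
    rw [this]
    exact Submodule.smul_mem _ _ hx
  | shift i => exact coeff_comp_vectorField_mem (shift_locFin i) β
  | tilt n v =>
    exact comp_mem_finFunctionals (coeff_comp_vectorField_mem (tilt_locFin n))
      (coeff_comp_mul_mem v.1 β)

theorem coeff_comp_rhoPS_mem (u : P.U) : ∀ β, coeff β ∘ₗ P.rhoPS u ∈ finFunctionals := by
  induction u using P.U_induction with
  | add u w hu hw => intro β; rw [map_add, LinearMap.comp_add]; exact add_mem (hu β) (hw β)
  | smul c u hu => intro β; rw [map_smul, LinearMap.comp_smul]; exact Submodule.smul_mem _ _ (hu β)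
  | one => intro β; rw [map_one]; exact Submodule.subset_span ⟨β, rfl⟩
  | mul x u hu =>
    intro β
    have : coeff β ∘ₗ P.rhoPS (P.toU x * u) = (coeff β ∘ₗ x.1.toLinearMap) ∘ₗ P.rhoPS u := by
      ext f
      exact congrArg (coeff β) (P.rhoPS_toU_mul x u f)
    rw [this]
    exact comp_mem_finFunctionals hu (P.coeff_comp_L_mem x β)

theorem finFunctionals_expand {φ : PS →ₗ[ℝ] ℝ} (hφ : φ ∈ finFunctionals) :
    ∃ c : MI →₀ ℝ, (∀ γ, φ (mon γ) = c γ) ∧ ∀ f, φ f = c.sum fun γ a => a * coeff γ f := by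
  classical
  obtain ⟨c, hc⟩ := Finsupp.mem_span_range_iff_exists_finsupp.1 hφ
  have h : ∀ f, φ f = c.sum fun γ a => a * coeff γ f := fun f => by
    rw [← hc, Finsupp.sum, LinearMap.sum_apply]
    rfl
  refine ⟨c, fun γ => ?_, h⟩
  rw [h, mon]
  simp only [coeff_monomial, mul_ite, mul_one, mul_zero]
  rw [Finsupp.sum_ite_eq']
  simpa using fun h => h.symm

theorem len_eq (n : N2) : P.len n = n 0 * P.len (unit 0) + n 1 * P.len (unit 1) := by
  have h : n = n 0 • unit 0 + n 1 • unit 1 := by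
    funext j
    fin_cases j <;> simp [unit]
  conv_lhs => rw [h]
  rw [map_add, map_nsmul, map_nsmul, nsmul_eq_mul, nsmul_eq_mul]

/-- The smaller one of `|(1,0)|` and `|(0,1)|`. -/
def mu : ℝ := min (P.len (unit 0)) (P.len (unit 1))

theorem mu_pos : 0 < P.mu := lt_min (P.len_unit_pos 0) (P.len_unit_pos 1)

theorem mu_le (i : Fin 2) : P.mu ≤ P.len (unit i) := by
  fin_cases i
  · exact min_le_left _ _
  · exact min_le_right _ _

theorem mul_mu_le_len (n : N2) (i : Fin 2) : n i * P.mu ≤ P.len n := by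
  have h0 := (P.len_unit_pos 0).le
  have h1 := (P.len_unit_pos 1).le
  have h2 : n i * P.mu ≤ n i * P.len (unit i) := by
    gcongr
    exact P.mu_le i
  rw [len_eq]
  have h3 : 0 ≤ (n 0 : ℝ) * P.len (unit 0) := by positivity
  have h4 : 0 ≤ (n 1 : ℝ) * P.len (unit 1) := by positivity
  fin_cases i
  · simp only [Fin.zero_eta] at h2 ⊢
    linarith
  · simp only [Fin.mk_one] at h2 ⊢
    linarith

theorem len_nonneg (n : N2) : 0 ≤ P.len n :=
  (mul_nonneg (Nat.cast_nonneg _) P.mu_pos.le).trans (P.mul_mu_le_len n 0)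

theorem mu_le_len {n : N2} (h : n ≠ 0) : P.mu ≤ P.len n := by
  obtain ⟨i, hi⟩ := Function.ne_iff.1 h
  refine le_trans ?_ (P.mul_mu_le_len n i)
  have : (1 : ℝ) ≤ n i := by exact_mod_cast Nat.one_le_iff_ne_zero.2 hi
  nlinarith [P.mu_pos]

theorem finite_len_lt (c : ℝ) : {n : N2 | P.len n < c}.Finite := by
  refine (Set.finite_Icc (0 : N2) fun _ => ⌈c / P.mu⌉₊).subset fun n hn => ⟨fun _ => Nat.zero_le _, fun i => ?_⟩
  have h1 := P.mul_mu_le_len n i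
  have h2 : (n i : ℝ) ≤ c / P.mu := by
    rw [le_div_iff₀ P.mu_pos]
    exact h1.trans (le_of_lt hn)
  exact_mod_cast h2.trans (Nat.le_ceil _)

theorem pw_nonneg (γ : MI) : 0 ≤ P.pw γ := by
  refine Finset.sum_nonneg fun v _ => ?_
  rcases v with k | m
  · simp
  · exact mul_nonneg (Nat.cast_nonneg _) (P.len_nonneg _)

/-- A degree on multi-indices that all generators of `L` raise by at least one. -/
def wt (γ : MI) : ℝ := br γ + P.hom γ / P.mu

/-- The amount by which a generator of `L` raises the degree `wt`. -/
def genWt (i : P.LIdx) : ℝ := P.wt (P.genIdx i) + 1 - P.len (P.genLen i) / P.mu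

theorem one_le_genWt (i : P.LIdx) : 1 ≤ P.genWt i := by
  have hmu := P.mu_pos
  rcases i with p | i
  · have h1 : (0 : ℝ) ≤ br p.1.1 := by exact_mod_cast p.2.1
    have h2 : P.len p.1.2 / P.mu ≤ P.hom p.1.1 / P.mu := by
      gcongr
      exact p.2.2.le
    simp only [genWt, wt, genIdx, genLen]
    linarith
  · have h2 : 1 ≤ P.len (unit i) / P.mu := by
      rw [one_le_div hmu]
      exact P.mu_le i
    simp only [genWt, wt, genIdx, genLen, hom, br_single_varAdd, pw_single_varAdd, map_zero,
      zero_add, zero_div]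
    push_cast
    simp only [neg_add_cancel, mul_zero, zero_add]
    linarith

/-- The total degree of `D_(J,m)`. -/
def wtJM (K : P.JM) : ℝ := K.sum fun i k => k * P.genWt i

theorem wtJM_add_single (K : P.JM) (i : P.LIdx) :
    P.wtJM (K + Finsupp.single i 1) = P.wtJM K + P.genWt i := by
  rw [wtJM, Finsupp.sum_add_index' (by simp) (fun _ _ _ => by push_cast; ring)]
  simp [wtJM]

theorem le_wtJM (K : P.JM) (i : P.LIdx) : K i * P.genWt i ≤ P.wtJM K := by
  have h0 : ∀ j, 0 ≤ (K j : ℝ) * P.genWt j := fun j =>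
    mul_nonneg (Nat.cast_nonneg _) (zero_le_one.trans (P.one_le_genWt j))
  by_cases hi : i ∈ K.support
  · exact Finset.single_le_sum (f := fun j => (K j : ℝ) * P.genWt j) (fun j _ => h0 j) hi
  · rw [Finsupp.notMem_support_iff.1 hi, Nat.cast_zero, zero_mul]
    exact Finset.sum_nonneg fun j _ => h0 j

theorem neg_one_le_wt {γ : MI} (h : InT γ) : -1 ≤ P.wt γ := by
  have hmu := P.mu_pos
  have hp := P.pw_nonneg γ
  rcases h with h | ⟨n, rfl⟩
  · have h1 : (0 : ℝ) ≤ br γ := by exact_mod_cast h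
    have hα := P.α_pos
    have h2 : 0 ≤ P.hom γ / P.mu := by
      rw [hom]
      positivity
    rw [wt]
    linarith
  · have h2 : P.hom (Finsupp.single (Sum.inr n) 1) = P.len n.1 := by simp [hom]
    have h3 : 0 ≤ P.len n.1 / P.mu := div_nonneg (P.len_nonneg _) hmu.le
    rw [wt, h2, br_single_inr]
    push_cast
    linarith

theorem coeff_rhoPS_DJM {K : P.JM} {f : PS} {β : MI} (h : coeff β (P.rhoPS (P.DJM K) f) ≠ 0) :
    (∃ γ, coeff γ f ≠ 0 ∧ P.wt β = P.wt γ + P.wtJM K) ∧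
      ∀ p : P.Pair, K (Sum.inl p) ≠ 0 → p.1.1 ≤ β := by
  induction K using P.JM_induction generalizing f β with
  | zero =>
    rw [DJM_zero, map_one, Module.End.one_apply] at h
    exact ⟨⟨β, h, by simp [wtJM]⟩, fun p hp => absurd rfl hp⟩
  | inr K i hK ih =>
    have h1 : coeff β (shift i (P.rhoPS (P.DJM K) f)) ≠ 0 := by
      rw [← P.rhoPS_DJM_add_inr hK, coeff_smul]
      exact mul_ne_zero (by positivity) h
    obtain ⟨δ, hδ, hs⟩ := exists_step (shift_locFin i) h1
    obtain ⟨⟨γ, hγ, hw⟩, -⟩ := ih hδ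
    refine ⟨⟨γ, hγ, ?_⟩, fun p hp => absurd (by simp [hK]) hp⟩
    obtain ⟨h2, h3⟩ := P.step_shift hs
    rw [wtJM_add_single, ← add_assoc, ← hw]
    simp only [wt, hom, genWt, genIdx, genLen, h2, h3, br_single_varAdd, pw_single_varAdd, map_zero]
    push_cast
    ring
  | inl K q ih =>
    have h1 : coeff β (mon q.1.1 * P.rhoPS (P.DJM K) (tilt q.1.2 f)) ≠ 0 := by
      rw [← P.rhoPS_DJM_add_inl, coeff_smul]
      exact mul_ne_zero (by positivity) h
    rw [mon, coeff_monomial_mul, one_mul] at h1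
    split_ifs at h1 with hle
    · obtain ⟨⟨δ, hδ, hw⟩, hp⟩ := ih h1
      obtain ⟨γ, hγ, hs⟩ := exists_step (tilt_locFin _) hδ
      obtain ⟨h2, h3⟩ := P.step_tilt hs
      have h4 : br β = br (β - q.1.1) + br q.1.1 := by rw [← br_add, tsub_add_cancel_of_le hle]
      have h5 : P.pw β = P.pw (β - q.1.1) + P.pw q.1.1 := by
        rw [← pw_add, tsub_add_cancel_of_le hle]
      refine ⟨⟨γ, hγ, ?_⟩, fun p hpK => ?_⟩
      · have h6 : P.pw δ = P.pw γ - P.len q.1.2 := by linarith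
        rw [wtJM_add_single]
        simp only [wt, hom, h2, h6] at hw
        simp only [wt, hom, genWt, genIdx, genLen, h4, h5]
        push_cast at hw ⊢
        have h7 : P.wtJM K = br (β - q.1.1) + (P.α * (br (β - q.1.1) + 1) + P.pw (β - q.1.1)) / P.mu
          - (br γ + 1 + (P.α * (br γ + 1 + 1) + (P.pw γ - P.len q.1.2)) / P.mu) := by linarith
        rw [h7]
        ring
      · by_cases hpq : p = q
        · rw [hpq]; exact hle
        · refine (hp p fun h0 => hpK ?_).trans tsub_le_self
          rw [Finsupp.add_apply, h0, Finsupp.single_eq_of_ne fun h => hpq (Sum.inl_injective h),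
            add_zero]
    · exact absurd rfl h1

theorem moduleCoeff_eq (β : TIdx) (K : P.JM) (γ : TIdx) :
    P.moduleCoeff β K γ = coeff β.1 (P.rhoPS (P.DJM K) (mon γ.1)) := by
  rw [moduleCoeff, coe_rho]
  rfl

theorem wt_eq_of_moduleCoeff_ne_zero {β γ : TIdx} {K : P.JM} (h : P.moduleCoeff β K γ ≠ 0) :
    P.wt β.1 = P.wt γ.1 + P.wtJM K := by
  rw [moduleCoeff_eq] at h
  obtain ⟨δ, hδ, hw⟩ := (P.coeff_rhoPS_DJM h).1
  rw [eq_of_coeff_monomial_ne_zero hδ] at hw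
  exact hw

theorem finite_pair_le (β : MI) : {p : P.Pair | p.1.1 ≤ β}.Finite := by
  have h : (⋃ γ ∈ Set.Iic β, {γ} ×ˢ {n : N2 | P.len n < P.hom γ}).Finite :=
    (Set.finite_Iic β).biUnion fun γ _ => (Set.finite_singleton γ).prod (P.finite_len_lt _)
  refine (h.preimage Subtype.val_injective.injOn).subset fun p hp => ?_
  simp only [Set.mem_preimage, Set.mem_iUnion]
  exact ⟨p.1.1, hp, rfl, p.2.2⟩

theorem finite_moduleCoeff (β : TIdx) :
    {p : P.JM × TIdx | P.moduleCoeff β p.1 p.2 ≠ 0}.Finite := by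
  classical
  set S : Finset P.LIdx := 
    (((P.finite_pair_le β.1).image Sum.inl).union (Set.finite_range Sum.inr)).toFinset
  set N := ⌈P.wt β.1 + 1⌉₊
  have hfin : (Set.Iic (∑ i ∈ S, Finsupp.single i N : P.JM)).Finite := Set.finite_Iic _
  have hrow : ∀ K : P.JM, {γ : TIdx | P.moduleCoeff β K γ ≠ 0}.Finite := fun K => by
    obtain ⟨c, hc, -⟩ := finFunctionals_expand (P.coeff_comp_rhoPS_mem (P.DJM K) β.1)
    refine (c.support.finite_toSet.preimage Subtype.val_injective.injOn).subset fun γ hγ => ?_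
    rw [Set.mem_ofPred_eq, moduleCoeff_eq] at hγ
    simp only [Set.mem_preimage, Finset.mem_coe, Finsupp.mem_support_iff, ← hc]
    exact hγ
  refine (hfin.biUnion fun K _ => (Set.finite_singleton K).prod (hrow K)).subset ?_
  rintro ⟨K, γ⟩ h
  simp only [Set.mem_iUnion]
  refine ⟨K, fun i => ?_, rfl, h⟩
  have hw := P.wt_eq_of_moduleCoeff_ne_zero h
  have hγ := P.neg_one_le_wt γ.2
  have hi := P.le_wtJM K i
  have h1 := P.one_le_genWt i
  have hN : K i ≤ N := by
    have h2 : (K i : ℝ) ≤ P.wt β.1 + 1 := by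
      have : (0 : ℝ) ≤ K i := Nat.cast_nonneg _
      nlinarith
    exact_mod_cast h2.trans (Nat.le_ceil _)
  rw [Finsupp.finsetSum_apply]
  by_cases h0 : K i = 0
  · rw [h0]; exact Nat.zero_le _
  have hS : i ∈ S := by
    simp only [S, Set.Finite.mem_toFinset]
    rcases i with p | i
    · left
      refine ⟨p, ?_, rfl⟩
      have h' : P.moduleCoeff β K γ ≠ 0 := h
      rw [moduleCoeff_eq] at h'
      exact (P.coeff_rhoPS_DJM h').2 p h0
    · exact Or.inr ⟨i, rfl⟩
  refine hN.trans ?_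
  have := Finset.single_le_sum (f := fun j => (Finsupp.single j N : P.JM) i)
    (fun _ _ => Nat.zero_le _) hS
  simpa using this

theorem coord_tensorProduct {ι κ A B : Type*} [AddCommGroup A] [Module ℝ A] [AddCommGroup B]
    [Module ℝ B] (bA : Module.Basis ι ℝ A) (bB : Module.Basis κ ℝ B) (i : ι) (j : κ) :
    (bA.tensorProduct bB).coord (i, j) = ev2 (bA.coord i) (bB.coord j) := by
  ext a b
  simp [mul_comm]

theorem tensor_ext {ι κ A B : Type*} [AddCommGroup A] [Module ℝ A] [AddCommGroup B]
    [Module ℝ B] (bA : Module.Basis ι ℝ A) (bB : Module.Basis κ ℝ B) {t t' : A ⊗[ℝ] B}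
    (h : ∀ i j, ev2 (bA.coord i) (bB.coord j) t = ev2 (bA.coord i) (bB.coord j) t') : t = t' := by
  refine (bA.tensorProduct bB).ext_elem fun ⟨i, j⟩ => ?_
  rw [← Module.Basis.coord_apply, ← Module.Basis.coord_apply, coord_tensorProduct, h]

/-- The embedding of `T⁺` into the dual of `U(L)` for which `Z^(J,m)` and `D_(J,m)` are dual. -/
def toDual : P.Tplus →ₗ[ℝ] P.U →ₗ[ℝ] ℝ :=
  (MvPolynomial.basisMonomials P.LIdx ℝ).constr ℝ fun K => P.basisU.coord K

theorem toDual_Z (K : P.JM) : P.toDual (P.Z K) = P.basisU.coord K := by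
  have h := (MvPolynomial.basisMonomials P.LIdx ℝ).constr_basis ℝ
    (fun K => P.basisU.coord K) K
  rwa [MvPolynomial.coe_basisMonomials] at h

theorem basisU_coord_DJM [DecidableEq P.LIdx] (K K' : P.JM) :
    P.basisU.coord K (P.DJM K') = if K' = K then 1 else 0 := by
  rw [← basisU_apply, Module.Basis.coord_apply, Module.Basis.repr_self, Finsupp.single_apply]

theorem toDual_Z_DJM [DecidableEq P.LIdx] (K K' : P.JM) :
    P.toDual (P.Z K) (P.DJM K') = if K' = K then 1 else 0 := by
  rw [toDual_Z, basisU_coord_DJM]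

/-- Functionals on `U(L)` agree if they agree on all `D_(J,m)`. -/
theorem functional_ext {M : Type*} [AddCommGroup M] [Module ℝ M] {f g : P.U →ₗ[ℝ] M}
    (h : ∀ K, f (P.DJM K) = g (P.DJM K)) : f = g :=
  P.basisU.ext fun K => by rw [basisU_apply, h]

/-- Linear maps on `T⁺` agree if they agree on all `Z^(J,m)`. -/
theorem Tplus_ext {M : Type*} [AddCommGroup M] [Module ℝ M] {f g : P.Tplus →ₗ[ℝ] M}
    (h : ∀ K, f (P.Z K) = g (P.Z K)) : f = g :=
  (MvPolynomial.basisMonomials P.LIdx ℝ).ext fun K => by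
    rw [MvPolynomial.coe_basisMonomials]
    exact h K

theorem Z_zero : P.Z 0 = 1 := rfl

theorem Z_add (A B : P.JM) : P.Z (A + B) = P.Z A * P.Z B := by
  rw [Z, Z, Z, MvPolynomial.monomial_mul, one_mul]

theorem toDual_one : P.toDual 1 = P.counitU.toLinearMap := by
  classical
  refine P.functional_ext fun K => ?_
  rw [← Z_zero, toDual_Z_DJM, AlgHom.toLinearMap_apply, counitU_DJM]

/-- Convolution of functionals is bilinear. -/
def convLin : (P.U →ₗ[ℝ] ℝ) →ₗ[ℝ] (P.U →ₗ[ℝ] ℝ) →ₗ[ℝ] P.U →ₗ[ℝ] ℝ :=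
  LinearMap.mk₂ ℝ P.conv
    (fun f f' g => by simp only [conv, ev2, TensorProduct.map_add_left, LinearMap.comp_add,
      LinearMap.add_comp])
    (fun c f g => by simp only [conv, ev2, TensorProduct.map_smul_left, LinearMap.comp_smul,
      LinearMap.smul_comp])
    (fun f g g' => by simp only [conv, ev2, TensorProduct.map_add_right, LinearMap.comp_add,
      LinearMap.add_comp])
    (fun c f g => by simp only [conv, ev2, TensorProduct.map_smul_right, LinearMap.comp_smul,
      LinearMap.smul_comp])

theorem toDual_mul (z z' : P.Tplus) : P.toDual (z * z') = P.conv (P.toDual z) (P.toDual z') := by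
  classical
  suffices h : (LinearMap.mul ℝ P.Tplus).compr₂ P.toDual
      = P.convLin.compl₁₂ P.toDual P.toDual from DFunLike.congr_fun (DFunLike.congr_fun h z) z'
  refine P.Tplus_ext fun A => P.Tplus_ext fun B => P.functional_ext fun K => ?_
  change P.toDual (P.Z A * P.Z B) (P.DJM K) = P.conv (P.toDual (P.Z A)) (P.toDual (P.Z B)) (P.DJM K)
  rw [P.conv_dual (P.toDual_Z_DJM A) (P.toDual_Z_DJM B), ← Z_add, toDual_Z_DJM]

theorem counit_Z [DecidableEq P.LIdx] (K : P.JM) : P.counit (P.Z K) = if K = 0 then 1 else 0 := by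
  rw [counit, Z, MvPolynomial.lcoeff_apply, MvPolynomial.coeff_monomial]

/-- The functional on `T⁺` given by `u ∈ U(L)`. -/
def evU (u : P.U) : P.Tplus →ₗ[ℝ] ℝ := P.toDual.flip u

theorem evU_apply (u : P.U) (z : P.Tplus) : P.evU u z = P.toDual z u := rfl

theorem evU_one : P.evU 1 = P.counit := by
  classical
  refine P.Tplus_ext fun K => ?_
  rw [evU_apply, ← DJM_zero, toDual_Z_DJM, counit_Z]
  simp only [eq_comm]

theorem evU_DJM (K : P.JM) :
    P.evU (P.DJM K) = (MvPolynomial.basisMonomials P.LIdx ℝ).coord K := by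
  classical
  refine P.Tplus_ext fun K' => ?_
  rw [evU_apply, toDual_Z_DJM, Module.Basis.coord_apply]
  have h := (MvPolynomial.basisMonomials P.LIdx ℝ).repr_self K'
  rw [MvPolynomial.coe_basisMonomials] at h
  rw [Z, h, Finsupp.single_apply]
  simp only [eq_comm]

theorem Tplus_tensor_ext {κ B : Type*} [AddCommGroup B] [Module ℝ B] (bB : Module.Basis κ ℝ B)
    {t t' : P.Tplus ⊗[ℝ] B}
    (h : ∀ u j, ev2 (P.evU u) (bB.coord j) t = ev2 (P.evU u) (bB.coord j) t') : t = t' :=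
  tensor_ext (MvPolynomial.basisMonomials P.LIdx ℝ) bB fun K j => by rw [← evU_DJM, h]

theorem Tplus_tensor_Tplus_ext {t t' : P.Tplus ⊗[ℝ] P.Tplus}
    (h : ∀ u v, ev2 (P.evU u) (P.evU v) t = ev2 (P.evU u) (P.evU v) t') : t = t' :=
  P.Tplus_tensor_ext (MvPolynomial.basisMonomials P.LIdx ℝ) fun u K => by rw [← evU_DJM, h]

theorem Tplus_ext_evU {z z' : P.Tplus} (h : ∀ u, P.evU u z = P.evU u z') : z = z' :=
  (MvPolynomial.basisMonomials P.LIdx ℝ).ext_elem fun K => by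
    rw [← Module.Basis.coord_apply, ← Module.Basis.coord_apply, ← evU_DJM, h]

/-- The pairing of `T` with `f ∈ T*`. -/
def evT (f : P.Tstar) : T →ₗ[ℝ] ℝ :=
  Finsupp.linearCombination ℝ fun β : TIdx => coeff β.1 (f : PS)

@[simp] theorem evT_zT (f : P.Tstar) (β : TIdx) : P.evT f (zT β) = coeff β.1 (f : PS) := by
  rw [evT, zT, Finsupp.linearCombination_single, one_smul]

theorem T_ext {M : Type*} [AddCommGroup M] [Module ℝ M] {f g : T →ₗ[ℝ] M}
    (h : ∀ β, f (zT β) = g (zT β)) : f = g :=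
  Finsupp.lhom_ext' fun β => LinearMap.ext_ring (h β)

theorem evT_monT (γ : TIdx) : P.evT (P.monT γ) = Finsupp.basisSingleOne.coord γ := by
  classical
  refine T_ext fun β => ?_
  rw [evT_zT, Module.Basis.coord_apply, Finsupp.basisSingleOne_repr, LinearEquiv.refl_apply, zT,
    Finsupp.single_apply]
  change coeff β.1 (monomial γ.1 (1 : ℝ)) = _
  rw [coeff_monomial]
  simp only [Subtype.ext_iff]

theorem Delta_zT (β : TIdx) : P.Delta (zT β) = ∑ p ∈ (P.finite_moduleCoeff β).toFinset,
    P.moduleCoeff β p.1 p.2 • (P.Z p.1 ⊗ₜ[ℝ] zT p.2) := by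
  rw [Delta, zT, Finsupp.linearCombination_single, one_smul]
  refine finsum_eq_sum_of_support_subset _ fun p hp => ?_
  simp only [Set.Finite.coe_toFinset, Set.mem_ofPred_eq]
  intro h
  exact hp (by simp only [h, zero_smul])

theorem coeff_rho_DJM (β : TIdx) (K : P.JM) (f : P.Tstar) [DecidableEq P.JM] :
    coeff β.1 (P.rho (P.DJM K) f : PS)
      = ∑ p ∈ (P.finite_moduleCoeff β).toFinset with p.1 = K,
          P.moduleCoeff β p.1 p.2 * coeff p.2.1 (f : PS) := by
  obtain ⟨c, hc, hf⟩ := finFunctionals_expand (P.coeff_comp_rhoPS_mem (P.DJM K) β.1)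
  have h1 := hf f.1
  rw [LinearMap.comp_apply, ← coe_rho] at h1
  rw [h1, Finsupp.sum]
  have hcm : ∀ γ : TIdx, c γ.1 = P.moduleCoeff β K γ := fun γ => by
    rw [moduleCoeff_eq, ← hc, LinearMap.comp_apply]
  symm
  refine Finset.sum_of_injOn (fun p => p.2.1) ?_ ?_ ?_ ?_
  · rintro ⟨a, b⟩ h ⟨a', b'⟩ h' hb
    simp only [Finset.coe_filter, Set.mem_ofPred_eq] at h h'
    exact Prod.ext (h.2.trans h'.2.symm) (Subtype.ext hb)
  · rintro ⟨a, b⟩ h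
    simp only [Finset.coe_filter, Set.Finite.mem_toFinset, Set.mem_ofPred_eq] at h
    obtain ⟨h, rfl⟩ := h
    simp only [Finset.mem_coe, Finsupp.mem_support_iff, hcm]
    exact h
  · intro γ hγ hγ'
    by_contra hne
    apply hγ'
    have hT : InT γ := f.2 γ (right_ne_zero_of_mul hne)
    refine ⟨(K, ⟨γ, hT⟩), ?_, rfl⟩
    simp only [Finset.coe_filter, Set.Finite.mem_toFinset, Set.mem_ofPred_eq, and_true]
    rw [← hcm]
    exact left_ne_zero_of_mul hne
  · rintro ⟨a, b⟩ h
    simp only [Finset.mem_filter] at h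
    obtain ⟨-, rfl⟩ := h
    rw [hcm]

theorem ev2_Delta (u : P.U) (f : P.Tstar) (z : T) :
    ev2 (P.evU u) (P.evT f) (P.Delta z) = P.evT (P.rho u f) z := by
  classical
  suffices h : ev2 (P.evU u) (P.evT f) ∘ₗ P.Delta = P.evT (P.rho u f) from DFunLike.congr_fun h z
  refine T_ext fun β => ?_
  rw [LinearMap.comp_apply, Delta_zT, map_sum, evT_zT]
  simp only [map_smul, ev2_tmul, evT_zT, evU_apply, toDual_Z, smul_eq_mul]
  have h2 : (∑ p ∈ (P.finite_moduleCoeff β).toFinset,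
        (P.moduleCoeff β p.1 p.2 * coeff p.2.1 (f : PS)) • P.basisU.coord p.1)
      = coeff β.1 ∘ₗ P.Tstar.toSubmodule.subtype ∘ₗ P.rho.toLinearMap.flip f := by
    refine P.functional_ext fun K => ?_
    change _ = coeff β.1 (P.rho (P.DJM K) f : PS)
    rw [coeff_rho_DJM, Finset.sum_filter, LinearMap.sum_apply]
    refine Finset.sum_congr rfl fun p _ => ?_
    rw [LinearMap.smul_apply, basisU_coord_DJM, smul_eq_mul, mul_ite, mul_one, mul_zero]
    simp only [eq_comm]
  have h3 := DFunLike.congr_fun h2 u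
  rw [LinearMap.sum_apply] at h3
  refine Eq.trans (Finset.sum_congr rfl fun p _ => ?_) h3
  rw [LinearMap.smul_apply, smul_eq_mul]
  ring

theorem exists_eta (n : N2) (β : TIdx) : ∃ z : P.Tplus, P.toDual z = P.coeffXi n β.1 ∧
    (z ≠ 0 → P.len n / P.mu ≤ P.wt β.1) := by
  classical
  by_cases h : ∃ K, P.coeffXi n β.1 (P.DJM K) ≠ 0
  · obtain ⟨K, hK⟩ := h
    refine ⟨P.coeffXi n β.1 (P.DJM K) • P.Z K, ?_, fun _ => ?_⟩
    · refine P.functional_ext fun K' => ?_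
      rw [map_smul, LinearMap.smul_apply, toDual_Z_DJM, smul_eq_mul]
      by_cases hKK : K' = K
      · rw [if_pos hKK, mul_one, hKK]
      · rw [if_neg hKK, mul_zero]
        by_contra hne
        apply hKK
        rcases P.xi_DJM n (Ne.symm hne) with ⟨hA', hK'⟩ | ⟨h0', -, hp', hβ'⟩ <;>
          rcases P.xi_DJM n hK with ⟨hA, hK⟩ | ⟨h0, -, hp, hβ⟩
        · rw [hK, hK']
        · have := hA'.1
          rw [hβ, br_single_inr] at this
          lia
        · have := hA.1
          rw [hβ', br_single_inr] at this
          lia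
        · rw [hβ] at hβ'
          have h1 := Finsupp.single_left_injective one_ne_zero hβ'
          simp only [Sum.inr.injEq, Subtype.mk.injEq] at h1
          have h2 := add_left_cancel h1
          ext j
          rcases j with q | j
          · rw [h0, h0']
          · exact (congrFun h2 j).symm
    · have hmu := P.mu_pos
      rcases P.xi_DJM n hK with ⟨hA, -⟩ | ⟨h0, hne, hp, hβ⟩
      · have h1 : (0 : ℝ) ≤ br β.1 := by exact_mod_cast hA.1
        have h2 : P.len n / P.mu ≤ P.hom β.1 / P.mu := by
          gcongr
          exact hA.2.le
        rw [wt]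
        linarith
      · have hm : (fun i => K (Sum.inr i)) ≠ 0 := fun hm => hne (by
          ext j
          rcases j with q | j
          · exact h0 q
          · exact congrFun hm j)
        have h1 := P.mu_le_len hm
        have h2 : P.wt β.1 = -1 + (P.len n + P.len fun i => K (Sum.inr i)) / P.mu := by
          rw [hβ, wt, hom, br_single_inr, pw_single_inr, map_add]
          push_cast
          ring
        have h3 : 1 ≤ (P.len fun i => K (Sum.inr i)) / P.mu := by rwa [one_le_div hmu]
        rw [h2, add_div]
        linarith
  · push Not at h
    exact ⟨0, by rw [map_zero]; exact P.functional_ext fun K => (h K).symm, fun h => absurd rfl h⟩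

/-- The map `T → T⁺` for which `eta n (z_β)` represents the functional `u ↦ (u z_n)_β`. -/
def eta (n : N2) : T →ₗ[ℝ] P.Tplus :=
  Finsupp.linearCombination ℝ fun β => (P.exists_eta n β).choose

theorem eta_zT (n : N2) (β : TIdx) : P.eta n (zT β) = (P.exists_eta n β).choose := by
  rw [eta, zT, Finsupp.linearCombination_single, one_smul]

theorem toDual_eta (n : N2) (β : TIdx) : P.toDual (P.eta n (zT β)) = P.coeffXi n β.1 := by
  rw [eta_zT]
  exact (P.exists_eta n β).choose_spec.1

theorem le_wt_of_eta_ne_zero {n : N2} {β : TIdx} (h : P.eta n (zT β) ≠ 0) :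
    P.len n / P.mu ≤ P.wt β.1 := by
  rw [eta_zT] at h
  exact (P.exists_eta n β).choose_spec.2 h

theorem evU_comp_eta (n : N2) (v : P.U) : P.evU v ∘ₗ P.eta n = P.evT (P.xi n v) := by
  refine T_ext fun β => ?_
  rw [LinearMap.comp_apply, evU_apply, toDual_eta, evT_zT, coeffXi_apply]

theorem eta_gen (i : P.LIdx) :
    P.eta (P.genLen i) (zT ⟨P.genIdx i, P.inT_genIdx i⟩) = P.Z (Finsupp.single i 1) := by
  classical
  refine P.Tplus_ext_evU fun u => ?_
  rw [evU_apply, evU_apply, toDual_eta]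
  refine DFunLike.congr_fun (P.functional_ext fun K => ?_) u
  rw [coeffXi_gen_DJM, toDual_Z_DJM]

theorem Tplus_induction {p : P.Tplus → Prop} (add : ∀ z w, p z → p w → p (z + w))
    (smul : ∀ (c : ℝ) z, p z → p (c • z)) (one : p 1) (mul : ∀ z w, p z → p w → p (z * w))
    (gen : ∀ i, p (P.Z (Finsupp.single i 1))) (z : P.Tplus) : p z := by
  induction z using MvPolynomial.induction_on with
  | C c =>
    have := smul c 1 one
    rwa [← MvPolynomial.C_eq_smul_one] at this
  | add z w hz hw => exact add z w hz hw
  | mul_X z i hz => exact mul z _ hz (gen i)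

/-- The pairing of `T⁺ ⊗ T⁺` with `U(L) ⊗ U(L)`. -/
def toDual2 : P.Tplus ⊗[ℝ] P.Tplus →ₗ[ℝ] P.U ⊗[ℝ] P.U →ₗ[ℝ] ℝ :=
  TensorProduct.dualDistrib ℝ P.U P.U ∘ₗ TensorProduct.map P.toDual P.toDual

theorem toDual2_tmul (a b : P.Tplus) :
    P.toDual2 (a ⊗ₜ b) = ev2 (P.toDual a) (P.toDual b) := by
  ext u v
  rfl

theorem toDual2_apply_tmul (t : P.Tplus ⊗[ℝ] P.Tplus) (u v : P.U) :
    P.toDual2 t (u ⊗ₜ v) = ev2 (P.evU u) (P.evU v) t := by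
  induction t using TensorProduct.induction_on with
  | zero => simp
  | add t t' h h' => rw [map_add, map_add, LinearMap.add_apply, h, h']
  | tmul a b => rw [toDual2_tmul]; rfl

/-- The tensor `t` represents the functional `(u, v) ↦ ⟨z, u v⟩`. -/
def IsComulOf (t : P.Tplus ⊗[ℝ] P.Tplus) (z : P.Tplus) : Prop :=
  P.toDual2 t = P.toDual z ∘ₗ LinearMap.mul' ℝ P.U

theorem isComulOf_iff {t : P.Tplus ⊗[ℝ] P.Tplus} {z : P.Tplus} :
    P.IsComulOf t z ↔ ∀ u v, ev2 (P.evU u) (P.evU v) t = P.toDual z (u * v) := by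
  constructor
  · intro h u v
    rw [← toDual2_apply_tmul, h]
    rfl
  · intro h
    refine TensorProduct.ext' fun u v => ?_
    rw [toDual2_apply_tmul, h]
    rfl

theorem isComulOf_one : P.IsComulOf 1 1 := by
  rw [isComulOf_iff]
  intro u v
  rw [Algebra.TensorProduct.one_def, ev2_tmul, evU_apply, evU_apply, toDual_one]
  exact (map_mul P.counitU u v).symm

/-- The pairing of `t t'` with two elements of `U(L) ⊗ U(L)`, contracted crosswise. -/
def crossPair (t t' : P.Tplus ⊗[ℝ] P.Tplus) (s r : P.U ⊗[ℝ] P.U) : ℝ :=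
  ev2 (P.toDual2 t) (P.toDual2 t') (TensorProduct.tensorTensorTensorComm ℝ P.U P.U P.U P.U (s ⊗ₜ r))

theorem crossPair_of_isComulOf {t t' : P.Tplus ⊗[ℝ] P.Tplus} {z w : P.Tplus}
    (hz : P.IsComulOf t z) (hw : P.IsComulOf t' w) (s r : P.U ⊗[ℝ] P.U) :
    P.crossPair t t' s r = ev2 (P.toDual z) (P.toDual w) (s * r) := by
  rw [crossPair, hz, hw]
  induction s using TensorProduct.induction_on with
  | zero => simp
  | add s s' h h' => rw [TensorProduct.add_tmul, map_add, map_add, h, h', add_mul, map_add]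
  | tmul a b =>
    induction r using TensorProduct.induction_on with
    | zero => simp
    | add s s' h h' => rw [TensorProduct.tmul_add, map_add, map_add, h, h', mul_add, map_add]
    | tmul c d =>
      rw [TensorProduct.tensorTensorTensorComm_tmul, Algebra.TensorProduct.tmul_mul_tmul]
      rfl

theorem crossPair_tmul (a b a' b' : P.Tplus) (s r : P.U ⊗[ℝ] P.U) :
    P.crossPair (a ⊗ₜ b) (a' ⊗ₜ b') s r
      = ev2 (P.toDual a) (P.toDual a') s * ev2 (P.toDual b) (P.toDual b') r := by
  rw [crossPair]
  induction s using TensorProduct.induction_on with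
  | zero => simp
  | add s s' h h' => rw [TensorProduct.add_tmul, map_add, map_add, h, h', map_add, add_mul]
  | tmul u v =>
    induction r using TensorProduct.induction_on with
    | zero => simp
    | add s s' h h' => rw [TensorProduct.tmul_add, map_add, map_add, h, h', map_add, mul_add]
    | tmul c d =>
      simp only [TensorProduct.tensorTensorTensorComm_tmul, ev2_tmul, toDual2_tmul]
      ring

theorem ev2_mul (t t' : P.Tplus ⊗[ℝ] P.Tplus) (u v : P.U) :
    ev2 (P.evU u) (P.evU v) (t * t') = P.crossPair t t' (P.comulU u) (P.comulU v) := by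
  induction t using TensorProduct.induction_on with
  | zero => simp [crossPair, ev2]
  | add t₁ t₂ h h' =>
    rw [add_mul, map_add, h, h']
    simp only [crossPair, ev2, map_add, TensorProduct.map_add_left, LinearMap.add_apply,
      LinearMap.comp_add]
  | tmul a b =>
    induction t' using TensorProduct.induction_on with
    | zero => simp [crossPair, ev2]
    | add t₁ t₂ h h' =>
      rw [mul_add, map_add, h, h']
      simp only [crossPair, ev2, map_add, TensorProduct.map_add_right, LinearMap.add_apply,
        LinearMap.comp_add]
    | tmul a' b' =>
      rw [crossPair_tmul, Algebra.TensorProduct.tmul_mul_tmul, ev2_tmul, evU_apply, evU_apply,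
        toDual_mul, toDual_mul]
      rfl

theorem IsComulOf.mul {t t' : P.Tplus ⊗[ℝ] P.Tplus} {z w : P.Tplus}
    (hz : P.IsComulOf t z) (hw : P.IsComulOf t' w) : P.IsComulOf (t * t') (z * w) := by
  rw [isComulOf_iff]
  intro u v
  rw [ev2_mul, P.crossPair_of_isComulOf hz hw, ← map_mul, toDual_mul]
  rfl

theorem ev2_comp_lTensor {A B C : Type*} [AddCommGroup A] [Module ℝ A] [AddCommGroup B]
    [Module ℝ B] [AddCommGroup C] [Module ℝ C] (f : A →ₗ[ℝ] ℝ) (g : C →ₗ[ℝ] ℝ) (φ : B →ₗ[ℝ] C)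
    (t : A ⊗[ℝ] B) : ev2 f g (φ.lTensor A t) = ev2 f (g ∘ₗ φ) t := by
  induction t using TensorProduct.induction_on with
  | zero => simp
  | add s s' h h' => simp only [map_add, h, h']
  | tmul a b => rfl

theorem ev2_comp_rTensor {A B C : Type*} [AddCommGroup A] [Module ℝ A] [AddCommGroup B]
    [Module ℝ B] [AddCommGroup C] [Module ℝ C] (f : C →ₗ[ℝ] ℝ) (g : B →ₗ[ℝ] ℝ) (φ : A →ₗ[ℝ] C)
    (t : A ⊗[ℝ] B) : ev2 f g (φ.rTensor B t) = ev2 (f ∘ₗ φ) g t := by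
  induction t using TensorProduct.induction_on with
  | zero => simp
  | add s s' h h' => simp only [map_add, h, h']
  | tmul a b => rfl

theorem ev2_assoc {A B C : Type*} [AddCommGroup A] [Module ℝ A] [AddCommGroup B]
    [Module ℝ B] [AddCommGroup C] [Module ℝ C] (f : A →ₗ[ℝ] ℝ) (g : B →ₗ[ℝ] ℝ) (h : C →ₗ[ℝ] ℝ)
    (t : (A ⊗[ℝ] B) ⊗[ℝ] C) :
    ev2 f (ev2 g h) (TensorProduct.assoc ℝ A B C t) = ev2 (ev2 f g) h t := by
  suffices H : ev2 f (ev2 g h) ∘ₗ (TensorProduct.assoc ℝ A B C).toLinearMap = ev2 (ev2 f g) h from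
    DFunLike.congr_fun H t
  refine TensorProduct.ext_threefold fun a b c => ?_
  simp [mul_assoc]

theorem isComulOf_eta (n : N2) (β : TIdx) :
    P.IsComulOf ((P.eta n).lTensor P.Tplus (P.Delta (zT β)) + P.eta n (zT β) ⊗ₜ[ℝ] 1)
      (P.eta n (zT β)) := by
  rw [isComulOf_iff]
  intro u v
  rw [map_add, ev2_comp_lTensor, evU_comp_eta, ev2_Delta, ev2_tmul, evU_apply, evU_apply, toDual_one,
    toDual_eta, evT_zT, coeffXi_apply, coeffXi_apply, xi_mul, AlgHom.toLinearMap_apply]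
  have : ((P.rho u (P.xi n v) + P.counitU v • P.xi n u : P.Tstar) : PS)
      = (P.rho u (P.xi n v) : PS) + P.counitU v • (P.xi n u : PS) := rfl
  rw [this, map_add, coeff_smul, mul_comm]

theorem exists_isComulOf (z : P.Tplus) : ∃ t, P.IsComulOf t z := by
  induction z using P.Tplus_induction with
  | add z w hz hw =>
    obtain ⟨t, ht⟩ := hz
    obtain ⟨t', ht'⟩ := hw
    exact ⟨t + t', by rw [IsComulOf, map_add, ht, ht', map_add, LinearMap.add_comp]⟩
  | smul c z hz =>
    obtain ⟨t, ht⟩ := hz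
    exact ⟨c • t, by rw [IsComulOf, map_smul, ht, map_smul, LinearMap.smul_comp]⟩
  | one => exact ⟨1, P.isComulOf_one⟩
  | mul z w hz hw =>
    obtain ⟨t, ht⟩ := hz
    obtain ⟨t', ht'⟩ := hw
    exact ⟨t * t', IsComulOf.mul P ht ht'⟩
  | gen i =>
    rw [← eta_gen]
    exact ⟨_, P.isComulOf_eta _ _⟩

theorem productCoeff_eq {t : P.Tplus ⊗[ℝ] P.Tplus} {K : P.JM} (ht : P.IsComulOf t (P.Z K))
    (p : P.JM × P.JM) :
    productCoeff P.basisU K p.1 p.2 = ((MvPolynomial.basisMonomials P.LIdx ℝ).tensorProduct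
      (MvPolynomial.basisMonomials P.LIdx ℝ)).repr t p := by
  have h := (P.isComulOf_iff.1 ht) (P.DJM p.1) (P.DJM p.2)
  rw [evU_DJM, evU_DJM, ← coord_tensorProduct, Module.Basis.coord_apply, toDual_Z,
    Module.Basis.coord_apply] at h
  rw [productCoeff, basisU_apply, basisU_apply, h]

theorem finite_productCoeff (K : P.JM) :
    {p : P.JM × P.JM | productCoeff P.basisU K p.1 p.2 ≠ 0}.Finite := by
  obtain ⟨t, ht⟩ := P.exists_isComulOf (P.Z K)
  simp only [P.productCoeff_eq ht]
  exact Finsupp.hasFiniteSupport _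

theorem isComulOf_DeltaPlus (z : P.Tplus) : P.IsComulOf (DeltaPlus P.basisU z) z := by
  suffices h : P.toDual2 ∘ₗ DeltaPlus P.basisU
      = (LinearMap.lcomp ℝ ℝ (LinearMap.mul' ℝ P.U)) ∘ₗ P.toDual from DFunLike.congr_fun h z
  refine P.Tplus_ext fun K => ?_
  obtain ⟨t, ht⟩ := P.exists_isComulOf (P.Z K)
  rw [LinearMap.comp_apply]
  suffices h : DeltaPlus P.basisU (P.Z K) = t by rw [h]; exact ht
  have h1 := (MvPolynomial.basisMonomials P.LIdx ℝ).constr_basis ℝ (fun K => ∑ᶠ p : P.JM × P.JM,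
    productCoeff P.basisU K p.1 p.2 • (P.Z p.1 ⊗ₜ[ℝ] P.Z p.2)) K
  rw [MvPolynomial.coe_basisMonomials] at h1
  rw [DeltaPlus, Z, h1]
  simp only [P.productCoeff_eq ht]
  set b := (MvPolynomial.basisMonomials P.LIdx ℝ).tensorProduct
    (MvPolynomial.basisMonomials P.LIdx ℝ) with hb
  rw [finsum_eq_sum_of_support_subset (s := (b.repr t).support)]
  · conv_rhs => rw [← b.linearCombination_repr t, Finsupp.linearCombination_apply, Finsupp.sum]
    refine Finset.sum_congr rfl fun p _ => ?_
    rw [hb, Module.Basis.tensorProduct_apply, MvPolynomial.coe_basisMonomials]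
    rfl
  · intro p hp
    simp only [Finset.mem_coe, Finsupp.mem_support_iff]
    intro h
    exact hp (by simp only [h, zero_smul])

theorem ev2_DeltaPlus (u v : P.U) (z : P.Tplus) :
    ev2 (P.evU u) (P.evU v) (DeltaPlus P.basisU z) = P.evU (u * v) z :=
  P.isComulOf_iff.1 (P.isComulOf_DeltaPlus z) u v

theorem ev2_comp_DeltaPlus (u v : P.U) :
    ev2 (P.evU u) (P.evU v) ∘ₗ DeltaPlus P.basisU = P.evU (u * v) :=
  LinearMap.ext (P.ev2_DeltaPlus u v)

theorem eq_of_isComulOf {t t' : P.Tplus ⊗[ℝ] P.Tplus} {z : P.Tplus} (h : P.IsComulOf t z)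
    (h' : P.IsComulOf t' z) : t = t' :=
  P.Tplus_tensor_Tplus_ext fun u v => by
    rw [P.isComulOf_iff.1 h, P.isComulOf_iff.1 h']

theorem conv_counitU (f : P.U →ₗ[ℝ] ℝ) : P.conv f P.counitU.toLinearMap = f := by
  classical
  refine P.functional_ext fun K => ?_
  rw [conv_DJM, Finset.sum_eq_single (K, 0)]
  · simp [DJM_zero]
  · rintro ⟨a, b⟩ h hne
    rw [AlgHom.toLinearMap_apply, counitU_DJM, if_neg, mul_zero]
    rintro rfl
    have := Finset.HasAntidiagonal.mem_antidiagonal.1 h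
    simp only [add_zero] at this
    exact hne (by rw [this])
  · intro h
    exact absurd (Finset.HasAntidiagonal.mem_antidiagonal.2 (add_zero K)) h

theorem conv_comp_antipodeU (f g : P.U →ₗ[ℝ] ℝ) :
    P.conv (f ∘ₗ P.antipodeU) (g ∘ₗ P.antipodeU) = P.conv f g ∘ₗ P.antipodeU := by
  ext u
  simp only [conv, LinearMap.comp_apply, AlgHom.toLinearMap_apply, comulU_antipodeU]
  induction P.comulU u using TensorProduct.induction_on with
  | zero => simp
  | add s s' h h' => simp only [map_add, h, h']
  | tmul a b => rfl

theorem antipode_mul_mem {z w : P.Tplus} (hz : P.toDual z ∘ₗ P.antipodeU ∈ LinearMap.range P.toDual)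
    (hw : P.toDual w ∘ₗ P.antipodeU ∈ LinearMap.range P.toDual) :
    P.toDual (z * w) ∘ₗ P.antipodeU ∈ LinearMap.range P.toDual := by
  obtain ⟨z', hz'⟩ := hz
  obtain ⟨w', hw'⟩ := hw
  exact ⟨z' * w', by rw [toDual_mul, toDual_mul, ← conv_comp_antipodeU, hz', hw']⟩

theorem antipode_one_mem : P.toDual 1 ∘ₗ P.antipodeU ∈ LinearMap.range P.toDual := by
  refine ⟨1, ?_⟩
  rw [toDual_one]
  ext u
  rw [LinearMap.comp_apply, AlgHom.toLinearMap_apply, AlgHom.toLinearMap_apply]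
  induction u using P.U_induction with
  | add u w hu hw => simp only [map_add, hu, hw]
  | smul c u hu => simp only [map_smul, hu]
  | one => rw [antipodeU_one]
  | mul x u hu =>
    rw [antipodeU_mul, map_mul P.counitU, map_mul P.counitU, antipodeU_toU, map_neg, counitU_toU]
    simp

theorem antipode_Z_mem {K : P.JM} (h : ∀ i, K i ≠ 0 →
    P.toDual (P.Z (Finsupp.single i 1)) ∘ₗ P.antipodeU ∈ LinearMap.range P.toDual) :
    P.toDual (P.Z K) ∘ₗ P.antipodeU ∈ LinearMap.range P.toDual := by
  have hZ : P.Z K = ∏ i ∈ K.support, P.Z (Finsupp.single i 1) ^ K i :=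
    (MvPolynomial.monomial_eq (s := K) (a := (1 : ℝ))).trans (by
      rw [map_one, one_mul]
      rfl)
  rw [hZ]
  refine Finset.prod_induction _
    (fun z => P.toDual z ∘ₗ P.antipodeU ∈ LinearMap.range P.toDual)
    (fun _ _ => P.antipode_mul_mem) P.antipode_one_mem fun i hi => ?_
  induction K i with
  | zero => rw [pow_zero]; exact P.antipode_one_mem
  | succ k ih => rw [pow_succ]; exact P.antipode_mul_mem ih (h i (Finsupp.mem_support_iff.1 hi))

theorem toDual2_rTensor_antipodeU {t : P.Tplus ⊗[ℝ] P.Tplus} {z : P.Tplus} (h : P.IsComulOf t z)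
    (u : P.U) : P.toDual2 t (P.antipodeU.rTensor P.U (P.comulU u)) = P.counitU u * P.counit z := by
  rw [h, LinearMap.comp_apply, mul_antipodeU_rTensor, map_smul, smul_eq_mul, ← evU_one, evU_apply]

theorem toDual2_lTensor_antipodeU {t : P.Tplus ⊗[ℝ] P.Tplus} {z : P.Tplus} (h : P.IsComulOf t z)
    (u : P.U) : P.toDual2 t (P.antipodeU.lTensor P.U (P.comulU u)) = P.counitU u * P.counit z := by
  rw [h, LinearMap.comp_apply, mul_antipodeU_lTensor, map_smul, smul_eq_mul, ← evU_one, evU_apply]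

theorem toDual2_tmul_rTensor (a b : P.Tplus) (u : P.U) :
    P.toDual2 (a ⊗ₜ b) (P.antipodeU.rTensor P.U (P.comulU u))
      = P.conv (P.toDual a ∘ₗ P.antipodeU) (P.toDual b) u := by
  rw [toDual2_tmul, ev2_comp_rTensor]
  rfl

theorem toDual2_tmul_lTensor (a b : P.Tplus) (u : P.U) :
    P.toDual2 (a ⊗ₜ b) (P.antipodeU.lTensor P.U (P.comulU u))
      = P.conv (P.toDual a) (P.toDual b ∘ₗ P.antipodeU) u := by
  rw [toDual2_tmul, ev2_comp_lTensor]
  rfl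

theorem antipode_gen_eq (i : P.LIdx) :
    P.toDual (P.Z (Finsupp.single i 1)) ∘ₗ P.antipodeU
      = -∑ p ∈ (P.finite_moduleCoeff ⟨P.genIdx i, P.inT_genIdx i⟩).toFinset,
        P.moduleCoeff ⟨P.genIdx i, P.inT_genIdx i⟩ p.1 p.2 •
          P.conv (P.toDual (P.Z p.1) ∘ₗ P.antipodeU) (P.toDual (P.eta (P.genLen i) (zT p.2))) := by
  classical
  rw [eq_neg_iff_add_eq_zero, add_comm]
  ext u
  have h := P.toDual2_rTensor_antipodeU (P.isComulOf_eta (P.genLen i) ⟨P.genIdx i, P.inT_genIdx i⟩) u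
  rw [eta_gen, counit_Z, if_neg (Finsupp.single_ne_zero.2 one_ne_zero), mul_zero, Delta_zT, map_sum,
    map_add, LinearMap.add_apply, toDual2_tmul_rTensor, toDual_one, conv_counitU, map_sum,
    LinearMap.sum_apply] at h
  rw [LinearMap.add_apply, LinearMap.sum_apply, LinearMap.zero_apply]
  refine Eq.trans (congrArg (· + _) ?_) h
  refine Finset.sum_congr rfl fun p _ => ?_
  rw [map_smul, LinearMap.lTensor_tmul, map_smul, LinearMap.smul_apply, LinearMap.smul_apply,
    toDual2_tmul_rTensor]

theorem antipode_gen_mem (N : ℕ) : ∀ i, P.genWt i ≤ N →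
    P.toDual (P.Z (Finsupp.single i 1)) ∘ₗ P.antipodeU ∈ LinearMap.range P.toDual := by
  induction N with
  | zero =>
    intro i hi
    have := P.one_le_genWt i
    push_cast at hi
    linarith
  | succ N ih =>
    intro i hi
    rw [antipode_gen_eq]
    refine neg_mem (sum_mem fun p hp => Submodule.smul_mem _ _ ?_)
    by_cases h0 : P.eta (P.genLen i) (zT p.2) = 0
    · rw [h0, map_zero]
      have : P.conv (P.toDual (P.Z p.1) ∘ₗ P.antipodeU) 0 = 0 := map_zero (P.convLin _)
      rw [this]
      exact zero_mem _
    · have h1 := P.le_wt_of_eta_ne_zero h0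
      have h2 := P.wt_eq_of_moduleCoeff_ne_zero ((Set.Finite.mem_toFinset _).1 hp)
      obtain ⟨w, hw⟩ := P.antipode_Z_mem (K := p.1) fun j hj => ih j (by
        have h3 := P.le_wtJM p.1 j
        have h4 := P.one_le_genWt j
        have h5 : (1 : ℝ) ≤ p.1 j := by exact_mod_cast Nat.one_le_iff_ne_zero.2 hj
        rw [genWt] at hi
        push_cast at hi
        nlinarith)
      exact ⟨w * P.eta (P.genLen i) (zT p.2), by rw [toDual_mul, hw]⟩

theorem exists_antipode : ∃ S : P.Tplus →ₗ[ℝ] P.Tplus,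
    ∀ z, P.toDual (S z) = P.toDual z ∘ₗ P.antipodeU := by
  have h : ∀ K, ∃ w, P.toDual w = P.toDual (P.Z K) ∘ₗ P.antipodeU := fun K =>
    P.antipode_Z_mem fun i _ => P.antipode_gen_mem _ i (Nat.le_ceil _)
  choose w hw using h
  refine ⟨(MvPolynomial.basisMonomials P.LIdx ℝ).constr ℝ w, fun z => ?_⟩
  suffices h : P.toDual ∘ₗ (MvPolynomial.basisMonomials P.LIdx ℝ).constr ℝ w
      = LinearMap.lcomp ℝ ℝ P.antipodeU ∘ₗ P.toDual from DFunLike.congr_fun h z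
  refine P.Tplus_ext fun K => ?_
  have h1 := (MvPolynomial.basisMonomials P.LIdx ℝ).constr_basis ℝ w K
  rw [MvPolynomial.coe_basisMonomials] at h1
  rw [LinearMap.comp_apply, Z, h1, hw]
  rfl

theorem evU_mul_rTensor {S : P.Tplus →ₗ[ℝ] P.Tplus}
    (hS : ∀ z, P.toDual (S z) = P.toDual z ∘ₗ P.antipodeU) (u : P.U) (t : P.Tplus ⊗[ℝ] P.Tplus) :
    P.evU u (LinearMap.mul' ℝ P.Tplus (S.rTensor P.Tplus t))
      = P.toDual2 t (P.antipodeU.rTensor P.U (P.comulU u)) := by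
  induction t using TensorProduct.induction_on with
  | zero => simp
  | add s s' h h' => simp only [map_add, h, h', LinearMap.add_apply]
  | tmul a b =>
    rw [toDual2_tmul_rTensor, LinearMap.rTensor_tmul, LinearMap.mul'_apply, evU_apply, toDual_mul, hS]

theorem evU_mul_lTensor {S : P.Tplus →ₗ[ℝ] P.Tplus}
    (hS : ∀ z, P.toDual (S z) = P.toDual z ∘ₗ P.antipodeU) (u : P.U) (t : P.Tplus ⊗[ℝ] P.Tplus) :
    P.evU u (LinearMap.mul' ℝ P.Tplus (S.lTensor P.Tplus t))
      = P.toDual2 t (P.antipodeU.lTensor P.U (P.comulU u)) := by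
  induction t using TensorProduct.induction_on with
  | zero => simp
  | add s s' h h' => simp only [map_add, h, h', LinearMap.add_apply]
  | tmul a b =>
    rw [toDual2_tmul_lTensor, LinearMap.lTensor_tmul, LinearMap.mul'_apply, evU_apply, toDual_mul, hS]

theorem evU_algebraMap (u : P.U) (c : ℝ) :
    P.evU u (Algebra.linearMap ℝ P.Tplus c) = P.counitU u * c := by
  rw [Algebra.linearMap_apply, Algebra.algebraMap_eq_smul_one, map_smul, evU_apply, toDual_one,
    AlgHom.toLinearMap_apply, smul_eq_mul, mul_comm]

theorem ext_three {t t' : P.Tplus ⊗[ℝ] (P.Tplus ⊗[ℝ] P.Tplus)}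
    (h : ∀ u v w, ev2 (P.evU u) (ev2 (P.evU v) (P.evU w)) t
      = ev2 (P.evU u) (ev2 (P.evU v) (P.evU w)) t') : t = t' :=
  P.Tplus_tensor_ext ((MvPolynomial.basisMonomials P.LIdx ℝ).tensorProduct
    (MvPolynomial.basisMonomials P.LIdx ℝ)) fun u ⟨K, K'⟩ => by
      rw [coord_tensorProduct, ← evU_DJM, ← evU_DJM, h]

theorem ext_three_T {t t' : P.Tplus ⊗[ℝ] (P.Tplus ⊗[ℝ] T)}
    (h : ∀ u v f, ev2 (P.evU u) (ev2 (P.evU v) (P.evT f)) t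
      = ev2 (P.evU u) (ev2 (P.evU v) (P.evT f)) t') : t = t' :=
  P.Tplus_tensor_ext ((MvPolynomial.basisMonomials P.LIdx ℝ).tensorProduct
    Finsupp.basisSingleOne) fun u ⟨K, γ⟩ => by
      rw [coord_tensorProduct, ← evU_DJM, ← evT_monT, h]

theorem apply_lid_rTensor {A B : Type*} [AddCommGroup A] [Module ℝ A] [AddCommGroup B]
    [Module ℝ B] (f : A →ₗ[ℝ] ℝ) (g : B →ₗ[ℝ] ℝ) (t : A ⊗[ℝ] B) :
    g (TensorProduct.lid ℝ B (f.rTensor B t)) = ev2 f g t := by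
  induction t using TensorProduct.induction_on with
  | zero => simp
  | add s s' h h' => simp only [map_add, h, h']
  | tmul a b => simp

theorem apply_rid_lTensor {A B : Type*} [AddCommGroup A] [Module ℝ A] [AddCommGroup B]
    [Module ℝ B] (f : A →ₗ[ℝ] ℝ) (g : B →ₗ[ℝ] ℝ) (t : A ⊗[ℝ] B) :
    f (TensorProduct.rid ℝ A (g.lTensor A t)) = ev2 f g t := by
  induction t using TensorProduct.induction_on with
  | zero => simp
  | add s s' h h' => simp only [map_add, h, h']
  | tmul a b => simp [mul_comm]

theorem isHopfAlgebra_Tplus : ∃ S : P.Tplus →ₗ[ℝ] P.Tplus,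
    IsHopfAlgebra (DeltaPlus P.basisU) P.counit S := by
  obtain ⟨S, hS⟩ := P.exists_antipode
  refine ⟨S, ?_, ?_, ?_, ?_, ?_, ?_, ?_, ?_, ?_⟩
  · refine LinearMap.ext fun z => P.ext_three fun u v w => ?_
    simp only [LinearMap.comp_apply, LinearEquiv.coe_coe]
    rw [ev2_assoc, ev2_comp_rTensor, ev2_comp_lTensor, ev2_comp_DeltaPlus, ev2_comp_DeltaPlus,
      ev2_DeltaPlus, ev2_DeltaPlus, mul_assoc]
  · refine LinearMap.ext fun z => (TensorProduct.lid ℝ P.Tplus).injective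
      (P.Tplus_ext_evU fun u => ?_)
    rw [LinearMap.comp_apply, apply_lid_rTensor, ← evU_one, ev2_DeltaPlus, one_mul]
    simp
  · refine LinearMap.ext fun z => (TensorProduct.rid ℝ P.Tplus).injective
      (P.Tplus_ext_evU fun u => ?_)
    rw [LinearMap.comp_apply, apply_rid_lTensor, ← evU_one, ev2_DeltaPlus, mul_one]
    simp
  · simp [counit]
  · intro a b
    simp [counit, ← MvPolynomial.constantCoeff_eq]
  · exact P.eq_of_isComulOf (P.isComulOf_DeltaPlus 1) P.isComulOf_one
  · intro a b
    exact P.eq_of_isComulOf (P.isComulOf_DeltaPlus _)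
      (IsComulOf.mul P (P.isComulOf_DeltaPlus a) (P.isComulOf_DeltaPlus b))
  · refine LinearMap.ext fun z => P.Tplus_ext_evU fun u => ?_
    simp only [LinearMap.comp_apply]
    rw [P.evU_mul_rTensor hS, P.toDual2_rTensor_antipodeU (P.isComulOf_DeltaPlus z), evU_algebraMap]
  · refine LinearMap.ext fun z => P.Tplus_ext_evU fun u => ?_
    simp only [LinearMap.comp_apply]
    rw [P.evU_mul_lTensor hS, P.toDual2_lTensor_antipodeU (P.isComulOf_DeltaPlus z), evU_algebraMap]

theorem isLeftComodule_T : IsLeftComodule (DeltaPlus P.basisU) P.counit P.Delta := by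
  refine ⟨?_, ?_⟩
  · refine LinearMap.ext fun z => P.ext_three_T fun u v f => ?_
    have h : ev2 (P.evU v) (P.evT f) ∘ₗ P.Delta = P.evT (P.rho v f) :=
      LinearMap.ext (P.ev2_Delta v f)
    simp only [LinearMap.comp_apply, LinearEquiv.coe_coe]
    rw [ev2_assoc, ev2_comp_rTensor, ev2_comp_lTensor, ev2_comp_DeltaPlus, h, ev2_Delta, ev2_Delta,
      map_mul]
    rfl
  · refine LinearMap.ext fun z => (TensorProduct.lid ℝ T).injective ?_
    refine Finsupp.basisSingleOne.ext_elem fun γ => ?_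
    rw [← Module.Basis.coord_apply, ← Module.Basis.coord_apply, ← P.evT_monT, LinearMap.comp_apply,
      apply_lid_rTensor, ← evU_one, ev2_Delta, map_one]
    simp

end Scaling
end MultiIndexHopf
end

theorem mainTheorem2 (P : MultiIndexHopf.Scaling) :
    ∃ b : Module.Basis P.JM ℝ P.U, (∀ K : P.JM, b K = P.DJM K) ∧
      (∀ K : P.JM,
        {p : P.JM × P.JM | MultiIndexHopf.Scaling.productCoeff b K p.1 p.2 ≠ 0}.Finite) ∧
      (∀ β : MultiIndexHopf.TIdx,
        {p : P.JM × MultiIndexHopf.TIdx | P.moduleCoeff β p.1 p.2 ≠ 0}.Finite) ∧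
      (∃ S : P.Tplus →ₗ[ℝ] P.Tplus,
        MultiIndexHopf.IsHopfAlgebra (MultiIndexHopf.Scaling.DeltaPlus b) P.counit S) ∧
      MultiIndexHopf.IsLeftComodule (MultiIndexHopf.Scaling.DeltaPlus b) P.counit P.Delta :=
  ⟨P.basisU, P.basisU_apply, P.finite_productCoeff, P.finite_moduleCoeff, P.isHopfAlgebra_Tplus,
    P.isLeftComodule_T⟩
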